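/- Let $\mathfrak g$ be a simple Lie algebra of type $A_n$ ($n\ge 1$), $D_n$ ($n\ge 4$), $E_6$, $E_7$ or $E_8$. Let $I$ be the vertex set of its Dynkin diagram and write $i\sim j$ for adjacent vertices. Let $C$ be the Cartan matrix, $\alpha_i$ the simple roots, $\varpi_i$ the fundamental weights, $(\cdot,\cdot)$ the scalar product on the rational span of the weight lattice with $(\alpha_i,\alpha_j)=C_{ij}$ (so $(\alpha_i,\varpi_j)=\delta_{ij}$), and $s_i(\lambda)=\lambda-(\lambda,\alpha_i)\alpha_i$ the simple reflections. Let $C(z)$ be the $I\times I$ matrix over $\mathbb{Q}(z)$ with $C_{ii}(z)=z+z^{-1}$, $C_{ij}(z)=-1$ if $i\sim j$, and $C_{ij}(z)=0$ otherwise, and let $\widetilde C_{ij}(m)$ be the coefficient of $z^m$ in the expansion at $z=0$ of the $(i,j)$ entry of $C(z)^{-1}$. Let $Q$ be a quiver obtained by orienting the Dynkin diagram, and let $\xi\colon I\to\mathbb{Z}$ satisfy $\xi_j=\xi_i-1$ for every arrow $i\to j$ of $Q$. For a vertex $i$, let $s_i(Q)$ be the quiver obtained by reversing all arrows with source or target $i$.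 Let $\tau=s_{i_1}\cdots s_{i_n}$ be the Coxeter element adapted to $Q$: $(i_1,\dots,i_n)$ is an ordering of $I$ such that $i_1$ is a source of $Q$ and $i_k$ is a source of $s_{i_{k-1}}\cdots s_{i_1}(Q)$ for $2\le k\le n$. Let $\gamma_i$ be the sum of the $\alpha_j$ over all $j\in I$ from which there is a path (possibly of length $0$) to $i$ in $Q$. Let $K$ be a field. For finite-dimensional representations $X,Y$ of $Q$ over $K$, put $\langle X,Y\rangle=\dim\operatorname{Hom}(X,Y)-\dim\operatorname{Ext}^1(X,Y)$, and identify dimension vectors with elements of the root lattice by $\underline{\dim}X=\sum_i \dim(X_i)\,\alpha_i$. Then these dimensions are finite, and there is a unique bilinear form on the rational span of the root lattice, the Ringel form, again denoted $\langle\cdot,\cdot\rangle$, with $\langle\underline{\dim}X,\underline{\dim}Y\rangle=\langle X,Y\rangle$ for all such $X,Y$. Moreover, for every $i\in I$ the simple representation $S_i$ at $i$ has an injective envelope $I_i$, and $\underline{\dim}\,I_i=\gamma_i$. Let $i,j\in I$ and let $m\ge 1$ be an integer. If $m+\xi_i-\xi_j-1$ is odd, then $\widetilde C_{ij}(m)=0$.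 If it is even, then $$\widetilde C_{ij}(m)=\left(\tau^{(m+\xi_i-\xi_j-1)/2}(\gamma_i),\ \varpi_j\right)=\left\langle \tau^{(m+\xi_i-\xi_j-1)/2}(\underline{\dim}\,I_i),\ \underline{\dim}\,I_j\right\rangle .$$ -/

import Mathlib

open CategoryTheory

universe u w

noncomputable section

section Cartan

variable {I : Type u}

open Classical in
/-- The (simply laced) Cartan matrix attached to a graph: `2` on the diagonal, `-1` for adjacent
vertices, and `0` otherwise. -/
def cartanMat (G : SimpleGraph I) : Matrix I I ℤ :=
  Matrix.of fun i j => if i = j then 2 else if G.Adj i j then -1 else 0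

/-- `G` is a Dynkin diagram of type `A_n` (`n ≥ 1`), `D_n` (`n ≥ 4`), `E_6`, `E_7` or `E_8`:
up to a labelling of the vertices, its Cartan matrix is one of the standard ones. -/
def IsDynkinADE (G : SimpleGraph I) : Prop :=
  (∃ n : ℕ, 1 ≤ n ∧ ∃ e : I ≃ Fin n, ∀ i j, cartanMat G i j = CartanMatrix.A n (e i) (e j)) ∨
  (∃ n : ℕ, 4 ≤ n ∧ ∃ e : I ≃ Fin n, ∀ i j, cartanMat G i j = CartanMatrix.D n (e i) (e j)) ∨
  (∃ e : I ≃ Fin 6, ∀ i j, cartanMat G i j = CartanMatrix.E₆ (e i) (e j)) ∨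
  (∃ e : I ≃ Fin 7, ∀ i j, cartanMat G i j = CartanMatrix.E₇ (e i) (e j)) ∨
  (∃ e : I ≃ Fin 8, ∀ i j, cartanMat G i j = CartanMatrix.E₈ (e i) (e j))

open Classical in
/-- The quantum Cartan matrix `C(z)`, with entries in `ℚ(z)`: `z + z⁻¹` on the diagonal, `-1` for
adjacent vertices, and `0` otherwise. -/
def quantumCartan (G : SimpleGraph I) : Matrix I I (RatFunc ℚ) :=
  Matrix.of fun i j =>
    if i = j then RatFunc.X + RatFunc.X⁻¹ else if G.Adj i j then -1 else 0

variable [Fintype I] [DecidableEq I]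

/-- The coefficient of `z ^ m` in the expansion at `z = 0` of the `(i, j)` entry of the inverse
(over `ℚ(z)`) of the quantum Cartan matrix. -/
def invQuantumCartanCoeff (G : SimpleGraph I) (i j : I) (m : ℤ) : ℚ :=
  (((quantumCartan G)⁻¹ i j : RatFunc ℚ) : LaurentSeries ℚ).coeff m

/-- The rational span of the weight lattice `P`, written in coordinates with respect to the
simple roots: `v : I → ℚ` stands for `∑ i, v i • α_i`. -/
abbrev WeightSpace (I : Type u) : Type u := I → ℚ

/-- The simple root `α_i`. -/
def simpleRoot (i : I) : WeightSpace I := Pi.single i 1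

/-- The scalar product, `(α_i, α_j) = C_ij`. -/
def scalarProd (G : SimpleGraph I) :
    WeightSpace I →ₗ[ℚ] WeightSpace I →ₗ[ℚ] ℚ :=
  Matrix.toBilin' ((cartanMat G).map (Int.cast : ℤ → ℚ))

/-- The fundamental weight `ϖ_j = ∑ k, (C⁻¹)_kj • α_k`, so that `(α_i, ϖ_j) = δ_ij`. -/
def fundWeight (G : SimpleGraph I) (j : I) : WeightSpace I :=
  fun k => ((cartanMat G).map (Int.cast : ℤ → ℚ))⁻¹ k j

theorem scalarProd_simpleRoot_self (G : SimpleGraph I) (i : I) :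
    (scalarProd G).flip (simpleRoot i) (simpleRoot i) = 2 := by
  simp [scalarProd, simpleRoot, cartanMat]

/-- The simple reflection `s_i(v) = v - (v, α_i) α_i`. -/
def simpleReflection (G : SimpleGraph I) (i : I) : WeightSpace I ≃ₗ[ℚ] WeightSpace I :=
  Module.reflection (scalarProd_simpleRoot_self G i)

end Cartan

section Quivers

variable {I : Type u} {G : SimpleGraph I}

/-- An orientation of a graph: every edge is given exactly one direction. `arrow i j` means that
there is an arrow `i → j`. -/
structure GraphOrientation (G : SimpleGraph I) where
  arrow : I → I → Prop
  adj_iff : ∀ i j, G.Adj i j ↔ arrow i j ∨ arrow j i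
  asymm : ∀ i j, arrow i j → ¬ arrow j i

namespace GraphOrientation

/-- The vertex set of the quiver `Q`. -/
def Vertex (_ : GraphOrientation G) : Type u := I

instance (Q : GraphOrientation G) : Quiver.{0} Q.Vertex where
  Hom i j := PLift (Q.arrow i j)

/-- The quiver `s_i(Q)`: every arrow with source or target `i` is reversed. -/
def mutate [DecidableEq I] (Q : GraphOrientation G) (i : I) : GraphOrientation G where
  arrow a b := if a = i ∨ b = i then Q.arrow b a else Q.arrow a b
  adj_iff a b := by
    have h := Q.adj_iff a b
    by_cases ha : a = i <;> by_cases hb : b = i <;> simp [ha, hb] at h ⊢ <;> tauto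
  asymm a b := by
    have h := Q.asymm a b
    by_cases ha : a = i <;> by_cases hb : b = i <;> simp [ha, hb] at h ⊢ <;> tauto

/-- `i` is a source of `Q`: no arrow ends at `i`. -/
def IsSource (Q : GraphOrientation G) (i : I) : Prop := ∀ j, ¬ Q.arrow j i

/-- A word `(i_1, ..., i_k)` is adapted to `Q` if `i_1` is a source of `Q`, `i_2` is a source of
`s_{i_1}(Q)`, and so on. -/
def IsAdapted [DecidableEq I] : GraphOrientation G → List I → Prop
  | _, [] => True
  | Q, i :: l => Q.IsSource i ∧ IsAdapted (Q.mutate i) l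

/-- `τ` is the Coxeter element adapted to `Q`: `τ = s_{i_1} ⋯ s_{i_n}` for an ordering
`(i_1, ..., i_n)` of all the vertices that is adapted to `Q`. -/
def IsAdaptedCoxeter [Fintype I] [DecidableEq I] (Q : GraphOrientation G)
    (τ : WeightSpace I ≃ₗ[ℚ] WeightSpace I) : Prop :=
  ∃ l : List I, l.Nodup ∧ (∀ i, i ∈ l) ∧ Q.IsAdapted l ∧ τ = (l.map (simpleReflection G)).prod

/-- A height function on `Q`: `ξ_j = ξ_i - 1` for every arrow `i → j`. -/
def IsHeightFunction (Q : GraphOrientation G) (ξ : I → ℤ) : Prop :=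
  ∀ i j, Q.arrow i j → ξ j = ξ i - 1

open Classical in
/-- `γ_i`, the sum of the simple roots `α_j` over all `j` from which there is a path to `i`
(including the path of length `0`). -/
def gammaRoot [Fintype I] (Q : GraphOrientation G) (i : I) : WeightSpace I :=
  ∑ j ∈ Finset.univ.filter (fun j => Relation.ReflTransGen Q.arrow j i), simpleRoot j

/-- The abelian category of finite-dimensional representations of `Q` over `K`, as functors on the
path category of `Q`. -/
abbrev FDRep (K : Type w) [Field K] (Q : GraphOrientation G) : Type (max u w (w + 1)) :=
  Paths Q.Vertex ⥤ FGModuleCat.{w} K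

variable {K : Type w} [Field K] {Q : GraphOrientation G}

/-- The dimension vector `∑ i, dim(X_i) α_i` of a representation. -/
def dimVec (X : FDRep K Q) : WeightSpace I :=
  fun i => (Module.finrank K (X.obj ((Paths.of Q.Vertex).obj i)) : ℚ)

variable (K Q) in
/-- The simple representation `S_i`: it is `K` at the vertex `i` and `0` at the other vertices, and
all arrows act by `0`. -/
def simpleRep (i : I) : FDRep K Q :=
  Paths.lift
    { obj := fun j => FGModuleCat.of K (PLift ((j : I) = i) → K)
      map := fun _ => 0 }

/-- `E` is an injective envelope of `S`: it is injective and there is an essential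
monomorphism `S ⟶ E`. -/
def IsInjectiveEnvelope (S E : FDRep K Q) : Prop :=
  Injective E ∧ ∃ f : S ⟶ E, Mono f ∧
    ∀ (Z : FDRep K Q) (g : E ⟶ Z), Mono (f ≫ g) → Mono g

/-- `Ext¹(X, Y)` in the category of finite-dimensional representations of `Q`. -/
abbrev Ext1 (X Y : FDRep K Q) : Type _ :=
  letI := HasExt.standard (FDRep K Q)
  Abelian.Ext X Y 1

/-- `B` is the Ringel form, seen as a bilinear form on (the rational span of) the root lattice:
for all `X` and `Y`, the spaces `Hom(X, Y)` and `Ext¹(X, Y)` are finite-dimensional and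
`B (dim X, dim Y) = dim Hom(X, Y) - dim Ext¹(X, Y)`. -/
def IsRingelForm (K : Type w) [Field K] (Q : GraphOrientation G)
    (B : WeightSpace I →ₗ[ℚ] WeightSpace I →ₗ[ℚ] ℚ) : Prop :=
  ∀ X Y : FDRep K Q, Module.Finite K (X ⟶ Y) ∧ Module.Finite K (Ext1 X Y) ∧
    B (dimVec X) (dimVec Y) = (Module.finrank K (X ⟶ Y) : ℚ) - (Module.finrank K (Ext1 X Y) : ℚ)

end GraphOrientation

end Quivers

end

-- Write `C(z) = z + z⁻¹ - A` with `A` the adjacency matrix. The Chebyshev recurrence `S_{n+1} +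
-- S_{n-1} = A S_n`, with `S_{-1} = 0` and `S_0 = 1`, says that `C(z)⁻¹ = ∑_{m ≥ 1} S_{m-1}(A) z^m`
-- (`invQuantumCartanCoeff_eq`). Everything then reduces to one identity (`zpow_gammaRoot_apply`):
-- the coefficient of `α_j` in `τ^k γ_i` is the `(i, j)` entry of `S_{2k + ξ_j - ξ_i}(A)`.
--
-- Both sides satisfy the same mesh relation. For the Chebyshev side it is the recurrence,
-- re-indexed by the height function. For the roots it comes from `γ_i = ϖ_i - τ ϖ_i` and from the
-- action of an adapted word on fundamental weights. The mesh relation propagates values from level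
-- `k` to levels `k ± 1`, so it suffices to compare at `k = 0`. There, `S_n(A)_{ij}` with `n = ξ_j -
-- ξ_i ≥ 0` only sees directed paths from `j` to `i`, of which there is at most one because the
-- diagram is a tree.
--
-- For the Ringel form, the path category is thin, so injectives are coinduced representations and
-- every representation has an explicit two-term injective resolution. It computes Hom and Ext¹ and
-- gives `⟨α_i, α_j⟩ = δ_ij - #{i → j}`. Since `Hom(X, I_j)` is dual to `X_j` and `Ext¹(X, I_j) =
-- 0`, pairing with `dim I_j = γ_j` reads off the `j`-th coordinate, exactly as pairing with `ϖ_j`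
-- does.

universe v w'

noncomputable section

/-! ### ADE diagrams: acyclicity and invertibility of the Cartan matrix. -/

section DynkinDiagrams

theorem adj_iff_cartanMat {I : Type u} (G : SimpleGraph I) (i j : I) :
    G.Adj i j ↔ cartanMat G i j = -1 := by
  by_cases hij : i = j
  · subst hij
    simp [cartanMat]
  · simp [cartanMat, hij]

theorem cartanMat_comm {I : Type u} (G : SimpleGraph I) (i j : I) : cartanMat G i j = cartanMat G j i := by
  have := G.adj_comm i j
  simp only [cartanMat, Matrix.of_apply]
  grind

/-- A simple graph in which every vertex has at most one neighbour of higher rank, for some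
injective ranking of the vertices, is acyclic. -/
theorem SimpleGraph.isAcyclic_of_rank {V : Type*} {G : SimpleGraph V} (r : V → ℕ)
    (hr : Function.Injective r)
    (h : ∀ a b c, G.Adj a b → G.Adj a c → r a < r b → r a < r c → b = c) : G.IsAcyclic := by
  classical
  intro v c hc
  -- At the vertex of least rank on a cycle, the two distinct neighbours along the cycle both have
  -- higher rank.
  obtain ⟨x, hx, hmin⟩ := c.support.toFinset.exists_min_image r ⟨v, by simp⟩
  rw [List.mem_toFinset] at hx
  set d := c.rotate x hx with hd
  have hdc : d.IsCycle := hc.rotate hx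
  have hlt : ∀ y ∈ d.support, G.Adj x y → r x < r y := by
    intro y hy hxy
    have hy' : y ∈ c.support := by
      simpa [hd, SimpleGraph.Walk.mem_support_rotate_iff] using hy
    exact lt_of_le_of_ne (hmin y (by simpa using hy')) fun e => hxy.ne (hr e)
  have h1 : G.Adj x d.snd := d.adj_snd hdc.not_nil
  have h2 : G.Adj x d.penultimate := (d.adj_penultimate hdc.not_nil).symm
  exact hdc.snd_ne_penultimate <| h x _ _ h1 h2
    (hlt _ (d.getVert_mem_support _) h1) (hlt _ (d.getVert_mem_support _) h2)

variable {I : Type u} {G : SimpleGraph I}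

theorem IsDynkinADE.isAcyclic (hG : IsDynkinADE G) : G.IsAcyclic := by
  rcases hG with ⟨n, -, e, he⟩ | ⟨n, hn, e, he⟩ | ⟨e, he⟩ | ⟨e, he⟩ | ⟨e, he⟩
  · refine G.isAcyclic_of_rank (fun i => e i) (fun a b h => e.injective (Fin.ext h)) ?_
    intro a b c hb hc hab hac
    rw [adj_iff_cartanMat, he] at hb hc
    simp only [CartanMatrix.A, Matrix.of_apply, Fin.ext_iff] at hb hc
    apply e.injective
    ext
    grind
  -- The numbering is reversed: in the standard one the branch vertex has two neighbours of higher
  -- index.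
  · refine G.isAcyclic_of_rank (fun i => n - 1 - e i)
      (fun a b h => e.injective (Fin.ext ?_)) ?_
    · have := (e a).2
      have := (e b).2
      simp only at h
      omega
    intro a b c hb hc hab hac
    rw [adj_iff_cartanMat, he] at hb hc
    simp only [CartanMatrix.D, Matrix.of_apply, Fin.ext_iff] at hb hc
    apply e.injective
    ext
    have ha := (e a).2
    generalize (e a : ℕ) = x at *
    generalize (e b : ℕ) = y at *
    generalize (e c : ℕ) = z at *
    split_ifs at hb <;> omega
  · have key : ∀ a b c : Fin 6, Matrix.of.symm CartanMatrix.E₆ a b = -1 → Matrix.of.symm CartanMatrix.E₆ a c = -1 →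
        a.1 < b.1 → a.1 < c.1 → b = c := by decide
    refine G.isAcyclic_of_rank (fun i => e i) (fun a b h => e.injective (Fin.ext h)) ?_
    intro a b c hb hc hab hac
    rw [adj_iff_cartanMat, he] at hb hc
    exact e.injective (key _ _ _ hb hc hab hac)
  · have key : ∀ a b c : Fin 7, Matrix.of.symm CartanMatrix.E₇ a b = -1 → Matrix.of.symm CartanMatrix.E₇ a c = -1 →
        a.1 < b.1 → a.1 < c.1 → b = c := by decide
    refine G.isAcyclic_of_rank (fun i => e i) (fun a b h => e.injective (Fin.ext h)) ?_
    intro a b c hb hc hab hac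
    rw [adj_iff_cartanMat, he] at hb hc
    exact e.injective (key _ _ _ hb hc hab hac)
  · have key : ∀ a b c : Fin 8, Matrix.of.symm CartanMatrix.E₈ a b = -1 → Matrix.of.symm CartanMatrix.E₈ a c = -1 →
        a.1 < b.1 → a.1 < c.1 → b = c := by decide
    refine G.isAcyclic_of_rank (fun i => e i) (fun a b h => e.injective (Fin.ext h)) ?_
    intro a b c hb hc hab hac
    rw [adj_iff_cartanMat, he] at hb hc
    exact e.injective (key _ _ _ hb hc hab hac)

/-- The extension by zero of a vector indexed by `Fin n` to the natural numbers. -/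
def extendFin {n : ℕ} (v : Fin n → ℤ) (k : ℕ) : ℤ := if h : k < n then v ⟨k, h⟩ else 0

theorem extendFin_val {n : ℕ} (v : Fin n → ℤ) (k : Fin n) : extendFin v k = v k := by
  simp [extendFin]

theorem extendFin_of_le {n : ℕ} (v : Fin n → ℤ) {k : ℕ} (h : n ≤ k) : extendFin v k = 0 := by
  simp [extendFin, h]

/-- Along a chain, the rows of the Cartan matrix make a kernel vector an arithmetic progression that
would vanish at index `-1`. One more linear condition at the far end then kills it. -/
theorem eq_zero_of_linear_recurrence {f : ℕ → ℤ} {N : ℕ}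
    (h0 : 0 < N → f 1 = 2 * f 0) (h : ∀ k, k + 1 < N → f (k + 2) = 2 * f (k + 1) - f k) :
    ∀ k ≤ N, f k = (k + 1) * f 0 := by
  intro k
  induction k using Nat.strong_induction_on with
  | _ k ih =>
    intro hk
    match k with
    | 0 => simp
    | 1 => rw [h0 (by omega)]; norm_num
    | k + 2 =>
      rw [h k (by omega), ih (k + 1) (by omega) (by omega), ih k (by omega) (by omega)]
      push_cast
      ring

/-- Extension by zero gives the last row the shape of the inner ones; the first row needs its own
case because `0 - 1 = 0` in `ℕ`. -/
theorem CartanMatrix.A_mulVec {n : ℕ} (v : Fin n → ℤ) (i : Fin n) :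
    (CartanMatrix.A n).mulVec v i = 2 * extendFin v i - extendFin v (i + 1)
      - if (i : ℕ) = 0 then 0 else extendFin v (i - 1) := by
  have h : (CartanMatrix.A n).mulVec v i = ∑ k ∈ Finset.range n,
      ((if k = i then 2 * extendFin v k else 0) - (if k = i + 1 then extendFin v k else 0)
        - (if k = i - 1 then if (i : ℕ) = 0 then 0 else extendFin v k else 0)) := by
    rw [← Fin.sum_univ_eq_sum_range (fun k =>
      ((if k = i then 2 * extendFin v k else 0) - (if k = i + 1 then extendFin v k else 0)
        - (if k = i - 1 then if (i : ℕ) = 0 then 0 else extendFin v k else 0)))]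
    simp only [Matrix.mulVec, dotProduct]
    refine Finset.sum_congr rfl fun j _ => ?_
    simp only [CartanMatrix.A, Matrix.of_apply, Fin.ext_iff, extendFin_val]
    generalize v j = t
    split_ifs <;> omega
  have hi := i.2
  have h1 : ¬ (i : ℕ) + 1 < n → extendFin v (i + 1) = 0 := fun h => extendFin_of_le v (by omega)
  rw [h]
  simp only [Finset.sum_sub_distrib, Finset.sum_ite_eq', Finset.mem_range]
  grind

theorem CartanMatrix.A_det_ne_zero (n : ℕ) (hn : 1 ≤ n) : (CartanMatrix.A n).det ≠ 0 := by
  intro hdet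
  obtain ⟨v, hv, h⟩ := Matrix.exists_mulVec_eq_zero_iff.2 hdet
  have row : ∀ i, ∀ hi : i < n, 2 * extendFin v i - extendFin v (i + 1)
      - (if i = 0 then 0 else extendFin v (i - 1)) = 0 := fun i hi => by
    rw [← CartanMatrix.A_mulVec v ⟨i, hi⟩, h, Pi.zero_apply]
  have key := eq_zero_of_linear_recurrence (f := extendFin v) (N := n)
    (fun h => by have := row 0 h; simp at this; linarith)
    (fun k hk => by have := row (k + 1) (by omega); simp at this; linarith)
  have h0 : extendFin v 0 = 0 := by
    have := key n le_rfl
    rw [extendFin_of_le v le_rfl] at this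
    rcases mul_eq_zero.1 this.symm with h | h
    · omega
    · exact h
  apply hv
  ext i
  rw [← extendFin_val v, key _ i.2.le, h0, mul_zero, Pi.zero_apply]

theorem CartanMatrix.D_mulVec_of_lt {n : ℕ} (v : Fin n → ℤ) (i : Fin n)
    (hi : i + 3 < n) : (CartanMatrix.D n).mulVec v i = (CartanMatrix.A n).mulVec v i := by
  simp only [Matrix.mulVec, dotProduct]
  refine Finset.sum_congr rfl fun j _ => congrArg (· * v j) ?_
  simp only [CartanMatrix.D, CartanMatrix.A, Matrix.of_apply, Fin.ext_iff]
  split_ifs <;> omega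

theorem CartanMatrix.D_mulVec_add {n : ℕ} (v : Fin n → ℤ) (i a b : Fin n) (x y : ℤ)
    (h : ∀ j, CartanMatrix.D n i j = CartanMatrix.A n i j + (if j = a then x else 0)
      + (if j = b then y else 0)) :
    (CartanMatrix.D n).mulVec v i = (CartanMatrix.A n).mulVec v i + x * v a + y * v b := by
  simp [Matrix.mulVec, dotProduct, h, add_mul, Finset.sum_add_distrib]

theorem CartanMatrix.D_det_ne_zero (n : ℕ) (hn : 4 ≤ n) : (CartanMatrix.D n).det ≠ 0 := by
  intro hdet
  obtain ⟨v, hv, h⟩ := Matrix.exists_mulVec_eq_zero_iff.2 hdet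
  obtain ⟨n, rfl⟩ := Nat.exists_eq_add_of_le' hn
  have row : ∀ i, ∀ hi : i < n + 4, (CartanMatrix.D (n + 4)).mulVec v ⟨i, hi⟩ = 0 :=
    fun i hi => congrFun h _
  have key := eq_zero_of_linear_recurrence (f := extendFin v) (N := n + 1)
    (fun h => by
      have := row 0 (by omega)
      rw [CartanMatrix.D_mulVec_of_lt _ _ (by simp), CartanMatrix.A_mulVec] at this
      simp at this
      linarith)
    (fun k hk => by
      have := row (k + 1) (by omega)
      rw [CartanMatrix.D_mulVec_of_lt _ _ (by simp; omega), CartanMatrix.A_mulVec] at this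
      simp at this
      linarith)
  have r1 := row (n + 1) (by omega)
  have r2 := row (n + 2) (by omega)
  have r3 := row (n + 3) (by omega)
  rw [CartanMatrix.D_mulVec_add v _ ⟨n + 3, by omega⟩ ⟨n + 3, by omega⟩ (-1) 0 (by
    rintro ⟨j, hj⟩
    simp only [CartanMatrix.D, CartanMatrix.A, Matrix.of_apply, Fin.mk.injEq]
    clear * - hn hj
    grind), CartanMatrix.A_mulVec, ← extendFin_val v] at r1
  rw [CartanMatrix.D_mulVec_add v _ ⟨n + 3, by omega⟩ ⟨n + 3, by omega⟩ 1 0 (by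
    rintro ⟨j, hj⟩
    simp only [CartanMatrix.D, CartanMatrix.A, Matrix.of_apply, Fin.mk.injEq]
    clear * - hn hj
    grind), CartanMatrix.A_mulVec, ← extendFin_val v] at r2
  rw [CartanMatrix.D_mulVec_add v _ ⟨n + 2, by omega⟩ ⟨n + 1, by omega⟩ 1 (-1) (by
    rintro ⟨j, hj⟩
    simp only [CartanMatrix.D, CartanMatrix.A, Matrix.of_apply, Fin.mk.injEq]
    clear * - hn hj
    grind), CartanMatrix.A_mulVec, ← extendFin_val v, ← extendFin_val v,
    extendFin_of_le v (k := n + 3 + 1) le_rfl] at r3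
  simp at r1 r2 r3
  have e0 := key n (by omega)
  have e1 := key (n + 1) (by omega)
  push_cast at e1
  -- The two leaf rows give each leaf half the value at the branch vertex `n + 1`. The branch row
  -- then says that the values at `n` and `n + 1` agree, so the progression is constant, hence zero.
  have h0 : extendFin v 0 = 0 := by linarith
  have h1 : extendFin v (n + 1) = 0 := by rw [e1, h0, mul_zero]
  apply hv
  ext i
  rw [← extendFin_val v, Pi.zero_apply]
  rcases Nat.lt_or_ge i (n + 2) with hi | hi
  · rw [key _ (by omega), h0, mul_zero]
  · have : (i : ℕ) = n + 2 ∨ (i : ℕ) = n + 3 := by omega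
    rcases this with e | e <;> rw [e] <;> linarith

theorem IsDynkinADE.det_cartanMat_ne_zero [Fintype I] [DecidableEq I] (hG : IsDynkinADE G) :
    (cartanMat G).det ≠ 0 := by
  have red : ∀ (n : ℕ) (e : I ≃ Fin n) (M : Matrix (Fin n) (Fin n) ℤ), M.det ≠ 0 →
      (∀ i j, cartanMat G i j = M (e i) (e j)) → (cartanMat G).det ≠ 0 := by
    intro n e M hM he
    have : cartanMat G = M.submatrix e e := by ext i j; exact he i j
    rwa [this, Matrix.det_submatrix_equiv_self]
  rcases hG with ⟨n, hn, e, he⟩ | ⟨n, hn, e, he⟩ | ⟨e, he⟩ | ⟨e, he⟩ | ⟨e, he⟩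
  · exact red n e _ (CartanMatrix.A_det_ne_zero n hn) he
  · exact red n e _ (CartanMatrix.D_det_ne_zero n hn) he
  · exact red 6 e _ (by rw [CartanMatrix.E₆_det]; decide) he
  · exact red 7 e _ (by rw [CartanMatrix.E₇_det]; decide) he
  · exact red 8 e _ (by rw [CartanMatrix.E₈_det]; decide) he

end DynkinDiagrams

/-! ### Directed paths, height functions and adapted words. -/

section DirectedPaths

variable {I : Type u} {G : SimpleGraph I} {Q : GraphOrientation G} {ξ : I → ℤ}

namespace GraphOrientation

theorem IsHeightFunction.le_of_reflTransGen (hξ : Q.IsHeightFunction ξ) {i j : I}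
    (h : Relation.ReflTransGen Q.arrow i j) : ξ j ≤ ξ i := by
  induction h with
  | refl => exact le_rfl
  | tail _ h ih => rw [hξ _ _ h]; omega

/-- The height drops at each arrow, so a directed path repeats no vertex; the bound on heights is
what shows that the appended vertex is new. -/
theorem IsHeightFunction.exists_path (hξ : Q.IsHeightFunction ξ) {i j : I}
    (h : Relation.ReflTransGen Q.arrow i j) :
    ∃ p : G.Walk i j, p.IsPath ∧ ∀ x ∈ p.support, ξ j ≤ ξ x := by
  induction h with
  | refl => exact ⟨.nil, by simp, by simp⟩
  | @tail b c _ h ih =>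
    obtain ⟨p, hp, hp'⟩ := ih
    have hbc := hξ _ _ h
    refine ⟨p.concat ((Q.adj_iff _ _).2 (Or.inl h)), hp.concat (fun hc => ?_) _, ?_⟩
    · have := hp' _ hc
      omega
    · intro x hx
      rw [SimpleGraph.Walk.support_concat] at hx
      simp only [List.mem_append, List.mem_singleton] at hx
      rcases hx with hx | rfl
      · have := hp' _ hx
        omega
      · exact le_rfl

/-- Over an acyclic graph, the last arrow of a directed path is determined by its endpoints. -/
theorem IsHeightFunction.eq_of_arrow (hξ : Q.IsHeightFunction ξ) (hG : G.IsAcyclic)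
    {i j k l : I} (hk : Relation.ReflTransGen Q.arrow j k) (hki : Q.arrow k i)
    (hl : Relation.ReflTransGen Q.arrow j l) (hli : Q.arrow l i) : k = l := by
  obtain ⟨p, hp, hp'⟩ := hξ.exists_path hk
  obtain ⟨q, hq, hq'⟩ := hξ.exists_path hl
  have h1 := hξ _ _ hki
  have h2 := hξ _ _ hli
  have e := (hG.subsingleton_path _ _).elim
    ⟨p.concat ((Q.adj_iff _ _).2 (Or.inl hki)), hp.concat (fun hc => by have := hp' _ hc; omega) _⟩
    ⟨q.concat ((Q.adj_iff _ _).2 (Or.inl hli)), hq.concat (fun hc => by have := hq' _ hc; omega) _⟩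
  simpa using congrArg SimpleGraph.Walk.penultimate (congrArg Subtype.val e)

theorem gammaRoot_apply [Fintype I] [DecidableEq I] (Q : GraphOrientation G) (i j : I)
    [Decidable (Relation.ReflTransGen Q.arrow j i)] :
    Q.gammaRoot i j = if Relation.ReflTransGen Q.arrow j i then 1 else 0 := by
  simp only [gammaRoot, simpleRoot, Finset.sum_apply, Pi.single_apply]
  rw [Finset.sum_filter, Finset.sum_eq_single j]
  · simp only [↓reduceIte]
  · intro k _ hk
    simp [hk.symm]
  · simp

open Classical in
-- A nontrivial path to `i` ends with an arrow `k → i`, and `k` is determined by the starting point,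
-- so the supports of the `γ_k` are disjoint.
theorem IsHeightFunction.gammaRoot_eq [Fintype I] [DecidableEq I] (hξ : Q.IsHeightFunction ξ)
    (hG : G.IsAcyclic) (i : I) :
    Q.gammaRoot i = simpleRoot i + ∑ k with Q.arrow k i, Q.gammaRoot k := by
  ext j
  simp only [Pi.add_apply, Finset.sum_apply, gammaRoot_apply, simpleRoot, Pi.single_apply]
  rw [Finset.sum_boole, Finset.filter_filter]
  by_cases hji : j = i
  · subst hji
    rw [Finset.filter_false_of_mem]
    · simp [Relation.ReflTransGen.refl]
    · rintro k - ⟨h1, h2⟩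
      have := hξ.le_of_reflTransGen h2
      have := hξ _ _ h1
      omega
  · by_cases h : Relation.ReflTransGen Q.arrow j i
    · obtain rfl | ⟨k, h1, h2⟩ := Relation.ReflTransGen.cases_tail h
      · exact absurd rfl hji
      · have : (Finset.univ.filter fun a => Q.arrow a i ∧ Relation.ReflTransGen Q.arrow j a)
            = {k} := by
          ext l
          simp only [Finset.mem_filter, Finset.mem_univ, true_and, Finset.mem_singleton]
          exact ⟨fun ⟨h3, h4⟩ => hξ.eq_of_arrow hG h4 h3 h1 h2, by rintro rfl; exact ⟨h2, h1⟩⟩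
        simp [this, h, hji]
    · rw [Finset.filter_false_of_mem]
      · simp [h, hji]
      · rintro k - ⟨h1, h2⟩
        exact h (h2.tail h1)

theorem reflTransGen_of_path (p : Σ a b : Q.Vertex, Quiver.Path a b) :
    Relation.ReflTransGen Q.arrow p.1 p.2.1 := by
  obtain ⟨a, b, p⟩ := p
  induction p with
  | nil => exact .refl
  | cons _ e ih => exact ih.tail e.down

/-- Thinness of the path category, on which the description of the injectives by coinduction rests.
-/
theorem IsHeightFunction.subsingleton_path (hξ : Q.IsHeightFunction ξ) (hG : G.IsAcyclic)
    {a b : Q.Vertex} (p q : Quiver.Path a b) : p = q := by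
  induction p with
  | nil =>
    cases q with
    | nil => rfl
    | cons q e =>
      have h1 := hξ.le_of_reflTransGen (reflTransGen_of_path ⟨_, _, q⟩)
      have h2 := hξ _ _ e.down
      simp only at h1
      omega
  | @cons b c p e ih =>
    cases q with
    | nil =>
      have h1 := hξ.le_of_reflTransGen (reflTransGen_of_path ⟨_, _, p⟩)
      have h2 := hξ _ _ e.down
      simp only at h1
      omega
    | @cons d _ q f =>
      obtain rfl : b = d := hξ.eq_of_arrow hG (reflTransGen_of_path ⟨_, _, p⟩) e.down
        (reflTransGen_of_path ⟨_, _, q⟩) f.down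
      rw [ih q]
      exact congrArg _ (Subsingleton.elim (α := PLift _) e f)

theorem nonempty_path_iff {a b : Q.Vertex} :
    Nonempty (Quiver.Path a b) ↔ Relation.ReflTransGen Q.arrow a b := by
  refine ⟨fun ⟨p⟩ => reflTransGen_of_path ⟨_, _, p⟩, fun h => ?_⟩
  induction h with
  | refl => exact ⟨.nil⟩
  | @tail b c _ h ih => exact ih.map fun p => p.cons (show b ⟶ c from ⟨h⟩)

/-- When its turn comes, `i` must be a source, so the arrow from `j` has been reversed; as `i` has
not occurred yet, only a mutation at `j` can have done it. -/
theorem IsAdapted.mem_of_arrow [DecidableEq I] {i j : I} {p s : List I} (Q : GraphOrientation G)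
    (hl : Q.IsAdapted (p ++ i :: s)) (hn : i ∉ p) (h : Q.arrow j i) : j ∈ p := by
  induction p generalizing Q with
  | nil => exact absurd h (hl.1 j)
  | cons a p ih =>
    rw [List.mem_cons, not_or] at hn
    by_cases hj : j = a
    · simp [hj]
    · refine List.mem_cons_of_mem _ (ih _ hl.2 hn.2 ?_)
      simpa [mutate, hj, hn.1] using h

theorem wellFounded_height [Finite I] (ξ : I → ℤ) : WellFounded fun a b => ξ b < ξ a :=
  haveI : IsTrans I fun a b => ξ b < ξ a := ⟨fun _ _ _ h h' => h'.trans h⟩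
  haveI : Std.Irrefl fun a b => ξ b < ξ a := ⟨fun _ => lt_irrefl _⟩
  Finite.wellFounded_of_trans_of_irrefl _

theorem wellFounded_depth [Finite I] (ξ : I → ℤ) : WellFounded fun a b => ξ a < ξ b :=
  haveI : IsTrans I fun a b => ξ a < ξ b := ⟨fun _ _ _ h h' => h.trans h'⟩
  haveI : Std.Irrefl fun a b => ξ a < ξ b := ⟨fun _ => lt_irrefl _⟩
  Finite.wellFounded_of_trans_of_irrefl _

theorem IsHeightFunction.adj (hξ : Q.IsHeightFunction ξ) {i k : I} (h : G.Adj i k) :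
    ξ k = ξ i - 1 ∨ ξ k = ξ i + 1 := by
  rcases (Q.adj_iff _ _).1 h with h | h
  · exact Or.inl (hξ _ _ h)
  · have := hξ _ _ h
    omega

end GraphOrientation

end DirectedPaths

end

noncomputable section

/-! ### The inverse quantum Cartan matrix through Chebyshev polynomials. -/

section QuantumCartanInverse

variable {I : Type u} [Fintype I] [DecidableEq I]

open Classical in
/-- The Chebyshev polynomial `S_n` evaluated at the adjacency matrix of a graph. -/
def chebyshevAdj (G : SimpleGraph I) (n : ℤ) : Matrix I I ℚ :=
  Polynomial.aeval (G.adjMatrix ℚ) (Polynomial.Chebyshev.S ℚ n)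

theorem chebyshevAdj_zero (G : SimpleGraph I) : chebyshevAdj G 0 = 1 := by
  simp [chebyshevAdj]

theorem chebyshevAdj_neg_one (G : SimpleGraph I) : chebyshevAdj G (-1) = 0 := by
  simp [chebyshevAdj]

theorem chebyshevAdj_neg_sub_two (G : SimpleGraph I) (n : ℤ) :
    chebyshevAdj G (-n - 2) = -chebyshevAdj G n := by
  simp [chebyshevAdj, Polynomial.Chebyshev.S_neg_sub_two]

open Classical in
theorem chebyshevAdj_recurrence (G : SimpleGraph I) (n : ℤ) (i j : I) :
    chebyshevAdj G (n + 1) i j + chebyshevAdj G (n - 1) i j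
      = ∑ k with G.Adj i k, chebyshevAdj G n k j := by
  have h : chebyshevAdj G (n + 1) = G.adjMatrix ℚ * chebyshevAdj G n - chebyshevAdj G (n - 1) := by
    simp [chebyshevAdj, Polynomial.Chebyshev.S_add_one]
  rw [h, Matrix.sub_apply, sub_add_cancel, Matrix.mul_apply, Finset.sum_filter]
  simp

/-- The `(i, j)` entry of the inverse quantum Cartan matrix, as a power series. -/
def invQuantumCartanSeries (G : SimpleGraph I) (i j : I) : PowerSeries ℚ :=
  PowerSeries.mk fun n => chebyshevAdj G (n - 1) i j

theorem coeff_invQuantumCartanSeries (G : SimpleGraph I) (i j : I) (n : ℕ) :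
    PowerSeries.coeff n (invQuantumCartanSeries G i j) = chebyshevAdj G (n - 1) i j :=
  PowerSeries.coeff_mk _ _

open Classical in
-- This is `C(z) C(z)⁻¹ = 1` multiplied by `z`, so that it can be checked among power series.
-- Degrees 0 and 1 use `S_{-1} = 0` and `S_0 = 1`, the others the Chebyshev recurrence.
theorem invQuantumCartanSeries_recurrence (G : SimpleGraph I) (i j : I) :
    (PowerSeries.X ^ 2 + 1) * invQuantumCartanSeries G i j
      - PowerSeries.X * ∑ k with G.Adj i k, invQuantumCartanSeries G k j
      = PowerSeries.X * PowerSeries.C (if i = j then 1 else 0) := by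
  ext n
  rw [add_mul, one_mul, pow_two, mul_assoc]
  rcases n with _ | _ | n
  · simp only [map_sub, map_add, PowerSeries.coeff_zero_X_mul,
      coeff_invQuantumCartanSeries]
    simp [chebyshevAdj_neg_one]
  · simp only [map_sub, map_add, map_sum, zero_add, PowerSeries.coeff_C,
      coeff_invQuantumCartanSeries,
      PowerSeries.coeff_zero_X_mul, PowerSeries.coeff_succ_X_mul 0]
    simp [chebyshevAdj_neg_one, chebyshevAdj_zero, Matrix.one_apply]
  · have h := chebyshevAdj_recurrence G n i j
    simp only [map_sub, map_add, PowerSeries.coeff_succ_X_mul, map_sum,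
      coeff_invQuantumCartanSeries, PowerSeries.coeff_C]
    have e1 : ((n + 1 + 1 : ℕ) : ℤ) - 1 = n + 1 := by push_cast; ring
    have e2 : ((n + 1 : ℕ) : ℤ) - 1 = n := by push_cast; ring
    rw [e1, e2, ← h, if_neg (Nat.succ_ne_zero n)]
    ring

open scoped RatFunc in
/-- The expansion of rational functions as Laurent series. -/
def ratFuncExpansion (F : Type u) [Field F] : RatFunc F →+* LaurentSeries F :=
  algebraMap (RatFunc F) (LaurentSeries F)

theorem quantumCartan_mul_series (G : SimpleGraph I) :
    (quantumCartan G).map (ratFuncExpansion ℚ) *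
      Matrix.of (fun i j => HahnSeries.ofPowerSeries ℤ ℚ (invQuantumCartanSeries G i j)) = 1 := by
  classical
  set φ := ratFuncExpansion ℚ with hφ
  set ψ := HahnSeries.ofPowerSeries ℤ ℚ with hψ
  have hX : φ RatFunc.X = ψ PowerSeries.X :=
    RatFunc.coe_X.trans PowerSeries.coe_X.symm
  have hX0 : ψ PowerSeries.X ≠ 0 := by
    rw [← hX]
    exact (map_ne_zero φ).2 RatFunc.X_ne_zero
  refine Matrix.ext fun i j => ?_
  have hrec := congrArg ψ (invQuantumCartanSeries_recurrence G i j)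
  simp only [map_sub, map_mul, map_add, map_pow, map_one, map_sum] at hrec
  have hC : ψ (PowerSeries.C (if i = j then 1 else 0)) = if i = j then 1 else 0 := by
    split_ifs <;> simp
  rw [hC] at hrec
  have hentry : ∀ k, (quantumCartan G).map φ i k
      = (if k = i then ψ PowerSeries.X + (ψ PowerSeries.X)⁻¹ else 0)
        + (if G.Adj i k then -1 else 0) := by
    intro k
    by_cases hik : k = i
    · subst hik
      simp [quantumCartan, hX]
    · simp only [quantumCartan, Matrix.map_apply, Matrix.of_apply, hik, Ne.symm hik, if_false,
        zero_add]
      split_ifs <;> simp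
  rw [Matrix.mul_apply]
  simp only [hentry, add_mul, Finset.sum_add_distrib, Matrix.of_apply, ite_mul, zero_mul, neg_one_mul,
    Finset.sum_ite_eq', Finset.mem_univ, if_true]
  rw [← Finset.sum_filter, Finset.sum_neg_distrib, Matrix.one_apply]
  apply mul_left_cancel₀ hX0
  rw [← hrec]
  field_simp
  ring

/-- The expansion at `z = 0` of the inverse quantum Cartan matrix. -/
theorem invQuantumCartanCoeff_eq (G : SimpleGraph I) (i j : I) (m : ℤ) (hm : 1 ≤ m) :
    invQuantumCartanCoeff G i j m = chebyshevAdj G (m - 1) i j := by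
  have h := quantumCartan_mul_series G
  set φ := ratFuncExpansion ℚ with hφ
  set N : Matrix I I (LaurentSeries ℚ) :=
    Matrix.of (fun i j => HahnSeries.ofPowerSeries ℤ ℚ (invQuantumCartanSeries G i j)) with hN
  -- A right inverse over Laurent series already forces the determinant over `ℚ(z)` to be nonzero.
  have hdet : IsUnit (quantumCartan G).det := by
    rw [isUnit_iff_ne_zero]
    intro h0
    have := congrArg Matrix.det h
    rw [Matrix.det_mul, Matrix.det_one, ← RingHom.mapMatrix_apply, ← RingHom.map_det, h0,
      map_zero, zero_mul] at this
    exact zero_ne_one this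
  have hinv : ((quantumCartan G)⁻¹).map φ = N := by
    have h1 : ((quantumCartan G)⁻¹).map φ * (quantumCartan G).map φ = 1 := by
      rw [← Matrix.map_mul, Matrix.nonsing_inv_mul _ hdet]
      simp
    rw [← mul_one (((quantumCartan G)⁻¹).map φ), ← h, ← mul_assoc, h1, one_mul]
  have hij : φ ((quantumCartan G)⁻¹ i j) = N i j := congrFun (congrFun hinv i) j
  obtain ⟨n, rfl⟩ := Int.eq_ofNat_of_zero_le (show 0 ≤ m by omega)
  change (φ ((quantumCartan G)⁻¹ i j)).coeff n = _
  rw [hij, hN, Matrix.of_apply, HahnSeries.ofPowerSeries_apply_coeff, coeff_invQuantumCartanSeries]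

end QuantumCartanInverse

end

noncomputable section

/-! ### The Coxeter element, the mesh relation and the comparison with Chebyshev entries. -/

section CoxeterElement

variable {I : Type u} [Fintype I] [DecidableEq I] {G : SimpleGraph I}

theorem simpleReflection_apply (G : SimpleGraph I) (i : I) (v : WeightSpace I) :
    simpleReflection G i v = v - scalarProd G v (simpleRoot i) • simpleRoot i := rfl

theorem isUnit_det_cartanMat_map (hG : (cartanMat G).det ≠ 0) :
    IsUnit ((cartanMat G).map (Int.cast : ℤ → ℚ)).det := by
  have : ((cartanMat G).map (Int.cast : ℤ → ℚ)).det = ((cartanMat G).det : ℚ) :=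
    ((Int.castRingHom ℚ).map_det (cartanMat G)).symm
  rw [this, isUnit_iff_ne_zero]
  exact_mod_cast hG

theorem scalarProd_comm (v x : WeightSpace I) : scalarProd G v x = scalarProd G x v := by
  simp only [scalarProd, Matrix.toBilin'_apply, Matrix.map_apply]
  rw [Finset.sum_comm]
  refine Finset.sum_congr rfl fun i _ => Finset.sum_congr rfl fun j _ => ?_
  rw [cartanMat_comm]
  ring

theorem scalarProd_fundWeight (hG : (cartanMat G).det ≠ 0) (v : WeightSpace I) (j : I) :
    scalarProd G v (fundWeight G j) = v j := by
  have h : ((cartanMat G).map (Int.cast : ℤ → ℚ)).mulVec (fundWeight G j) = Pi.single j 1 := by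
    ext k
    change (((cartanMat G).map (Int.cast : ℤ → ℚ)) * ((cartanMat G).map (Int.cast : ℤ → ℚ))⁻¹) k j
      = _
    rw [Matrix.mul_nonsing_inv _ (isUnit_det_cartanMat_map hG), Matrix.one_apply, Pi.single_apply]
  rw [scalarProd, Matrix.toBilin'_apply', h]
  simp

theorem scalarProd_fundWeight_simpleRoot (hG : (cartanMat G).det ≠ 0) (i j : I) :
    scalarProd G (fundWeight G i) (simpleRoot j) = if i = j then 1 else 0 := by
  rw [scalarProd_comm, scalarProd_fundWeight hG, simpleRoot, Pi.single_apply]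

open Classical in
theorem simpleRoot_eq_sum_fundWeight (hG : (cartanMat G).det ≠ 0) (i : I) :
    simpleRoot i = (2 : ℚ) • fundWeight G i - ∑ k with G.Adj i k, fundWeight G k := by
  set C := (cartanMat G).map (Int.cast : ℤ → ℚ) with hC
  ext j
  have h : (C⁻¹ * C) j i = (1 : Matrix I I ℚ) j i := by
    rw [Matrix.nonsing_inv_mul _ (isUnit_det_cartanMat_map hG)]
  rw [Matrix.one_apply, Matrix.mul_apply] at h
  have hCk : ∀ k, C k i = (if k = i then 2 else 0) - (if G.Adj i k then 1 else 0) := by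
    intro k
    by_cases hk : k = i
    · simp [hC, cartanMat, hk]
    · simp only [hC, cartanMat, Matrix.map_apply, Matrix.of_apply, hk, if_false, G.adj_comm k i]
      split_ifs <;> simp
  simp only [hCk, mul_sub, Finset.sum_sub_distrib, mul_ite, mul_zero, mul_one,
    Finset.sum_ite_eq', Finset.mem_univ, if_true] at h
  simp only [simpleRoot, Pi.single_apply, Pi.sub_apply, Pi.smul_apply, Finset.sum_apply, fundWeight,
    smul_eq_mul]
  rw [← h, Finset.sum_filter, mul_comm]

/-- The product of simple reflections attached to a word. -/
def wordProd (G : SimpleGraph I) (l : List I) : WeightSpace I ≃ₗ[ℚ] WeightSpace I :=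
  (l.map (simpleReflection G)).prod

theorem wordProd_append (l l' : List I) : wordProd G (l ++ l') = wordProd G l * wordProd G l' := by
  simp [wordProd]

theorem wordProd_cons (i : I) (l : List I) :
    wordProd G (i :: l) = simpleReflection G i * wordProd G l := by
  simp [wordProd]

theorem wordProd_fundWeight_of_notMem (hG : (cartanMat G).det ≠ 0) {i : I} {l : List I}
    (h : i ∉ l) : wordProd G l (fundWeight G i) = fundWeight G i := by
  induction l with
  | nil => simp [wordProd]
  | cons a l ih =>
    rw [List.mem_cons, not_or] at h
    rw [wordProd_cons, LinearEquiv.mul_apply, ih h.2, simpleReflection_apply,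
      scalarProd_fundWeight_simpleRoot hG, if_neg h.1]
    simp

theorem wordProd_fundWeight (hG : (cartanMat G).det ≠ 0) {i : I} {p s : List I}
    (hs : i ∉ s) :
    wordProd G (p ++ i :: s) (fundWeight G i)
      = wordProd G p (fundWeight G i) - wordProd G p (simpleRoot i) := by
  rw [wordProd_append, wordProd_cons, LinearEquiv.mul_apply, LinearEquiv.mul_apply,
    wordProd_fundWeight_of_notMem hG hs, simpleReflection_apply,
    scalarProd_fundWeight_simpleRoot hG, if_pos rfl, one_smul, map_sub]

namespace GraphOrientation

variable {Q : GraphOrientation G}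

open Classical in
theorem sum_adj {M : Type*} [AddCommMonoid M] (Q : GraphOrientation G) (i : I) (f : I → M) :
    ∑ k with G.Adj i k, f k = ∑ k with Q.arrow i k, f k + ∑ k with Q.arrow k i, f k := by
  rw [← Finset.sum_union]
  · congr 1
    ext k
    simp [Q.adj_iff]
  · rw [Finset.disjoint_filter]
    exact fun k _ h => Q.asymm _ _ h

variable {τ : WeightSpace I ≃ₗ[ℚ] WeightSpace I}

open Classical in
-- Split the word as `p, i, s`. Since `s_a` fixes `ϖ_i` for `a ≠ i`, the left side is `w_p(α_i)`;
-- expand `α_i` in fundamental weights. Targets `k` of arrows from `i` come after `i`, so `w_p`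
-- fixes `ϖ_k`; sources `k` of arrows to `i` lie in `p`, so `w_p` acts on `ϖ_k` as `τ`.
theorem IsAdaptedCoxeter.fundWeight_sub (hG : (cartanMat G).det ≠ 0) (hτ : Q.IsAdaptedCoxeter τ)
    (i : I) :
    fundWeight G i - τ (fundWeight G i) = (2 : ℚ) • fundWeight G i
      - (∑ k with Q.arrow i k, fundWeight G k + ∑ k with Q.arrow k i, τ (fundWeight G k)) := by
  obtain ⟨l, hnd, hmem, had, hτl⟩ := hτ
  change τ = wordProd G l at hτl
  subst hτl
  obtain ⟨p, s, rfl⟩ := List.append_of_mem (hmem i)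
  rw [List.nodup_append] at hnd
  obtain ⟨hp, his, hps⟩ := hnd
  have hip : i ∉ p := fun h => hps _ h i (by simp) rfl
  have hi : i ∉ s := (List.nodup_cons.1 his).1
  have hin : ∀ k, Q.arrow k i →
      wordProd G p (fundWeight G k) = wordProd G (p ++ i :: s) (fundWeight G k) := by
    intro k hk
    have hkp := had.mem_of_arrow Q hip hk
    rw [wordProd_append, LinearEquiv.mul_apply, wordProd_fundWeight_of_notMem hG (l := i :: s)]
    exact fun h => hps _ hkp _ h rfl
  have hout : ∀ k, Q.arrow i k → wordProd G p (fundWeight G k) = fundWeight G k := by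
    intro k hk
    refine wordProd_fundWeight_of_notMem hG fun hkp => ?_
    obtain ⟨p₁, p₂, rfl⟩ := List.append_of_mem hkp
    rw [List.append_assoc, List.cons_append] at had
    refine hip (List.mem_append_left _ (had.mem_of_arrow Q ?_ hk))
    intro h
    exact (List.nodup_append.1 hp).2.2 _ h k (by simp) rfl
  have h1 : fundWeight G i - wordProd G (p ++ i :: s) (fundWeight G i)
      = wordProd G p (simpleRoot i) := by
    rw [wordProd_fundWeight hG hi, wordProd_fundWeight_of_notMem hG hip]
    abel
  rw [h1, simpleRoot_eq_sum_fundWeight hG, map_sub, map_smul, wordProd_fundWeight_of_notMem hG hip,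
    map_sum, sum_adj Q]
  congr 2
  · exact Finset.sum_congr rfl fun k hk => hout k (Finset.mem_filter.1 hk).2
  · exact Finset.sum_congr rfl fun k hk => hin k (Finset.mem_filter.1 hk).2

open Classical in
-- The recursion of `IsHeightFunction.gammaRoot_eq`; induction from the highest vertices down then
-- identifies its two solutions.
theorem IsAdaptedCoxeter.fundWeight_sub_eq (hG : (cartanMat G).det ≠ 0)
    (hτ : Q.IsAdaptedCoxeter τ) (i : I) :
    fundWeight G i - τ (fundWeight G i) = simpleRoot i
      + ∑ k with Q.arrow k i, (fundWeight G k - τ (fundWeight G k)) := by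
  rw [hτ.fundWeight_sub hG, simpleRoot_eq_sum_fundWeight hG, sum_adj Q, Finset.sum_sub_distrib]
  abel

variable {ξ : I → ℤ}

theorem IsAdaptedCoxeter.gammaRoot_eq (hG : (cartanMat G).det ≠ 0) (hA : G.IsAcyclic)
    (hξ : Q.IsHeightFunction ξ) (hτ : Q.IsAdaptedCoxeter τ) (i : I) :
    Q.gammaRoot i = fundWeight G i - τ (fundWeight G i) := by
  classical
  induction i using (wellFounded_height ξ).induction with
  | _ i ih =>
    rw [hξ.gammaRoot_eq hA, hτ.fundWeight_sub_eq hG]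
    congr 1
    refine Finset.sum_congr rfl fun k hk => ih k ?_
    have := hξ _ _ (Finset.mem_filter.1 hk).2
    omega

open Classical in
/-- The mesh relation satisfied by the roots `γ_i` and their images under the Coxeter element. -/
theorem IsAdaptedCoxeter.gammaRoot_mesh (hG : (cartanMat G).det ≠ 0) (hA : G.IsAcyclic)
    (hξ : Q.IsHeightFunction ξ) (hτ : Q.IsAdaptedCoxeter τ) (i : I) :
    Q.gammaRoot i + τ (Q.gammaRoot i)
      = ∑ k with Q.arrow i k, Q.gammaRoot k + ∑ k with Q.arrow k i, τ (Q.gammaRoot k) := by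
  -- The fundamental weights satisfy the mesh relation; applying `1 - τ` transfers it to the `γ_i`.
  have h : fundWeight G i + τ (fundWeight G i)
      = ∑ k with Q.arrow i k, fundWeight G k + ∑ k with Q.arrow k i, τ (fundWeight G k) := by
    have := hτ.fundWeight_sub hG i
    rw [two_smul] at this
    have h2 := congrArg (fun x => fundWeight G i + fundWeight G i - x) this
    simp only [sub_sub_cancel] at h2
    rw [← h2]
    abel
  have h' := congrArg τ h
  simp only [hτ.gammaRoot_eq hG hA hξ, Finset.sum_sub_distrib, map_sub, map_add, map_sum] at h' ⊢
  rw [add_comm (∑ k with Q.arrow i k, _ - _), ← sub_eq_zero] at *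
  rw [← sub_eq_zero] at h
  have := congrArg₂ (· - ·) h h'
  simp only [sub_zero] at this
  rw [← this]
  abel

/-- `S_n(A)` involves only walks of length at most `n`, and each edge changes the height by one. Two
consecutive indices are carried because the recurrence has order two. -/
theorem IsHeightFunction.chebyshevAdj_eq_zero (hξ : Q.IsHeightFunction ξ) (n : ℕ) (i j : I)
    (h : n < |ξ j - ξ i|) : chebyshevAdj G n i j = 0 ∧ chebyshevAdj G (n - 1) i j = 0 := by
  classical
  induction n generalizing i j with
  | zero =>
    have : i ≠ j := by rintro rfl; simp at h
    simp [chebyshevAdj_zero, chebyshevAdj_neg_one, this]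
  | succ n ih =>
    push_cast at h ⊢
    have h0 := ih i j (by omega)
    refine ⟨?_, by simpa using h0.1⟩
    rw [← add_sub_cancel_right (chebyshevAdj G (n + 1) i j) (chebyshevAdj G (n - 1) i j),
      chebyshevAdj_recurrence, h0.2, sub_zero]
    refine Finset.sum_eq_zero fun k hk => (ih k j ?_).1
    have := hξ.adj (Finset.mem_filter.1 hk).2
    grind

/-- A walk of length `n` from `i` to a vertex `n` higher climbs at each step, so it is a directed
path from `j` to `i` read backwards. Formally, only the arrows into `i` survive in the recurrence,
as in that of `γ_i`. -/
theorem IsHeightFunction.chebyshevAdj_natCast (hξ : Q.IsHeightFunction ξ) (hA : G.IsAcyclic)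
    (n : ℕ) (i j : I) (h : ξ j - ξ i = n) : chebyshevAdj G n i j = Q.gammaRoot i j := by
  classical
  induction n generalizing i j with
  | zero =>
    rw [Nat.cast_zero, chebyshevAdj_zero, Matrix.one_apply, hξ.gammaRoot_eq hA, Pi.add_apply,
      Finset.sum_apply, Finset.sum_eq_zero, add_zero, simpleRoot, Pi.single_apply]
    · exact if_congr eq_comm rfl rfl
    · intro k hk
      have := hξ _ _ (Finset.mem_filter.1 hk).2
      rw [gammaRoot_apply, if_neg]
      intro h'
      have := hξ.le_of_reflTransGen h'
      simp at h
      omega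
  | succ n ih =>
    push_cast at h ⊢
    have hij : j ≠ i := by rintro rfl; simp at h; omega
    rw [← add_sub_cancel_right (chebyshevAdj G (n + 1) i j) (chebyshevAdj G (n - 1) i j),
      chebyshevAdj_recurrence, (hξ.chebyshevAdj_eq_zero n i j (by grind)).2, sub_zero, sum_adj Q,
      Finset.sum_eq_zero, zero_add, hξ.gammaRoot_eq hA, Pi.add_apply, simpleRoot,
      Pi.single_eq_of_ne hij, zero_add, Finset.sum_apply]
    · refine Finset.sum_congr rfl fun k hk => ih k j ?_
      have := hξ _ _ (Finset.mem_filter.1 hk).2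
      omega
    · intro k hk
      have := hξ _ _ (Finset.mem_filter.1 hk).2
      exact (hξ.chebyshevAdj_eq_zero n k j (by grind)).1

/-- The initial slice `k = 0`. If `j` is lower than `i`, both sides vanish: use `S_{-1} = 0`, or
`S_{-n-2} = -S_n` at vertices whose heights differ by `n + 2`. -/
theorem IsHeightFunction.chebyshevAdj_slice (hξ : Q.IsHeightFunction ξ) (hA : G.IsAcyclic)
    (i j : I) : chebyshevAdj G (ξ j - ξ i) i j = Q.gammaRoot i j := by
  classical
  rcases le_or_gt 0 (ξ j - ξ i) with h | h
  · obtain ⟨n, hn⟩ := Int.eq_ofNat_of_zero_le h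
    rw [hn]
    exact hξ.chebyshevAdj_natCast hA n i j hn
  · rw [gammaRoot_apply, if_neg]
    swap
    · intro h'
      have := hξ.le_of_reflTransGen h'
      omega
    obtain h1 | h1 : ξ j - ξ i = -1 ∨ 0 ≤ -(ξ j - ξ i) - 2 := by omega
    · rw [h1, chebyshevAdj_neg_one, Matrix.zero_apply]
    · obtain ⟨n, hn⟩ := Int.eq_ofNat_of_zero_le h1
      have hn' : ξ j - ξ i = -(n : ℤ) - 2 := by
        have : ((n : ℕ) : ℤ) = Int.ofNat n := rfl
        omega
      rw [hn', chebyshevAdj_neg_sub_two, Matrix.neg_apply,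
        (hξ.chebyshevAdj_eq_zero n i j (by grind)).1, neg_zero]

/-- `S_n` has the parity of `n`, and the parity of `ξ` is a proper 2-colouring of the graph. -/
theorem IsHeightFunction.chebyshevAdj_of_odd (hξ : Q.IsHeightFunction ξ) (n : ℕ) :
    (∀ i j, Odd (n + ξ i - ξ j) → chebyshevAdj G n i j = 0) ∧
      ∀ i j, Odd (n - 1 + ξ i - ξ j) → chebyshevAdj G (n - 1) i j = 0 := by
  classical
  induction n with
  | zero =>
    refine ⟨fun i j h => ?_, fun i j h => by simp [chebyshevAdj_neg_one]⟩
    have : i ≠ j := by rintro rfl; simp at h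
    simp [chebyshevAdj_zero, this]
  | succ n ih =>
    push_cast
    simp only [add_sub_cancel_right]
    refine ⟨fun i j h => ?_, ih.1⟩
    rw [← add_sub_cancel_right (chebyshevAdj G (n + 1) i j) (chebyshevAdj G (n - 1) i j),
      chebyshevAdj_recurrence, ih.2 i j (by grind), sub_zero]
    refine Finset.sum_eq_zero fun k hk => ih.1 k j ?_
    have := hξ.adj (Finset.mem_filter.1 hk).2
    grind

theorem IsAdaptedCoxeter.zpow_gammaRoot_apply (hG : (cartanMat G).det ≠ 0) (hA : G.IsAcyclic)
    (hξ : Q.IsHeightFunction ξ) (hτ : Q.IsAdaptedCoxeter τ) (k : ℤ) (i j : I) :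
    (τ ^ k) (Q.gammaRoot i) j = chebyshevAdj G (2 * k + ξ j - ξ i) i j := by
  classical
  have mesh : ∀ (k : ℤ) (i : I), (τ ^ k) (Q.gammaRoot i) j + (τ ^ (k + 1)) (Q.gammaRoot i) j
      = ∑ l with Q.arrow i l, (τ ^ k) (Q.gammaRoot l) j
        + ∑ l with Q.arrow l i, (τ ^ (k + 1)) (Q.gammaRoot l) j := by
    intro k i
    have := congrFun (congrArg (τ ^ k) (hτ.gammaRoot_mesh hG hA hξ i)) j
    simpa only [map_add, map_sum, Pi.add_apply, Finset.sum_apply, zpow_add_one,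
      LinearEquiv.mul_apply] using this
  -- The recurrence at index `2k + 1 + ξ_j - ξ_i`; passing to a neighbour `l` absorbs the shift by
  -- one into `ξ_l = ξ_i ± 1`.
  have mesh' : ∀ (k : ℤ) (i : I),
      chebyshevAdj G (2 * k + ξ j - ξ i) i j + chebyshevAdj G (2 * (k + 1) + ξ j - ξ i) i j
      = ∑ l with Q.arrow i l, chebyshevAdj G (2 * k + ξ j - ξ l) l j
        + ∑ l with Q.arrow l i, chebyshevAdj G (2 * (k + 1) + ξ j - ξ l) l j := by
    intro k i
    have h := chebyshevAdj_recurrence G (2 * k + 1 + ξ j - ξ i) i j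
    rw [sum_adj Q, add_comm] at h
    convert h using 2
    · exact congrArg (chebyshevAdj G · i j) (by ring)
    · exact congrArg (chebyshevAdj G · i j) (by ring)
    · refine Finset.sum_congr rfl fun l hl => ?_
      rw [hξ _ _ (Finset.mem_filter.1 hl).2]
      exact congrArg (chebyshevAdj G · l j) (by ring)
    · refine Finset.sum_congr rfl fun l hl => ?_
      have := hξ _ _ (Finset.mem_filter.1 hl).2
      exact congrArg (chebyshevAdj G · l j) (by omega)
  induction k using Int.induction_on generalizing i with
  | zero => simpa using (hξ.chebyshevAdj_slice hA i j).symm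
  | succ k ih =>
    -- Going up, the level `k + 1` terms on the right sit at sources of arrows into `i`, which are
    -- higher; going down, the unknown terms sit at lower vertices, so the second induction runs the
    -- other way.
    induction i using (wellFounded_height ξ).induction with
    | _ i ih' =>
      have h1 := mesh k i
      have h2 := mesh' k i
      rw [ih i, Finset.sum_congr rfl fun l _ => ih l, Finset.sum_congr rfl fun l hl => ih' l (by
        have := hξ _ _ (Finset.mem_filter.1 hl).2
        omega), ← h2] at h1
      exact add_left_cancel h1
  | pred k ih =>
    induction i using (wellFounded_depth ξ).induction with
    | _ i ih' =>
      have h1 := mesh (-k - 1) i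
      have h2 := mesh' (-k - 1) i
      simp only [sub_add_cancel] at h1 h2
      rw [ih i, Finset.sum_congr rfl fun l hl => ih' l (by
        have := hξ _ _ (Finset.mem_filter.1 hl).2
        omega), Finset.sum_congr rfl fun l _ => ih l, ← h2] at h1
      exact add_right_cancel h1

end GraphOrientation

end CoxeterElement

end

noncomputable section

/-! ### Coinduced representations of a thin category and their injectivity. -/

section Coinduction

variable {K : Type w} [Field K] {C : Type u} [Category.{v} C]

instance finite_plift_prop (p : Prop) : Finite (PLift p) :=
  haveI : Subsingleton (PLift p) := ⟨fun ⟨_⟩ ⟨_⟩ => rfl⟩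
  inferInstance

/-- The coinduced representation `a ↦ ∏ₓ V x ^ [a ≤ σ x]` of a thin category. -/
def coind {ι : Type} [Finite ι] (σ : ι → C) (V : ι → FGModuleCat.{w} K) :
    C ⥤ FGModuleCat.{w} K where
  obj a := FGModuleCat.of K (∀ x, PLift (Nonempty (a ⟶ σ x)) → V x)
  map f := FGModuleCat.ofHom
    { toFun := fun φ x h => φ x ⟨h.down.map (f ≫ ·)⟩
      map_add' := fun _ _ => rfl
      map_smul' := fun _ _ => rfl }

theorem FGModuleCat.mono_iff_injective {A B : FGModuleCat.{w} K} (f : A ⟶ B) :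
    Mono f ↔ Function.Injective f.hom.hom := by
  rw [← (forget₂ (FGModuleCat K) (ModuleCat K)).mono_map_iff_mono f]
  exact ModuleCat.mono_iff_injective _

theorem FGModuleCat.epi_iff_surjective {A B : FGModuleCat.{w} K} (f : A ⟶ B) :
    Epi f ↔ Function.Surjective f.hom.hom := by
  rw [← (forget₂ (FGModuleCat K) (ModuleCat K)).epi_map_iff_epi f]
  exact ModuleCat.epi_iff_surjective _

theorem mono_iff_injective_app {X Y : C ⥤ FGModuleCat.{w} K} (f : X ⟶ Y) :
    Mono f ↔ ∀ a, Function.Injective (f.app a).hom.hom := by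
  rw [NatTrans.mono_iff_mono_app]
  exact forall_congr' fun a => FGModuleCat.mono_iff_injective _

theorem epi_iff_surjective_app {X Y : C ⥤ FGModuleCat.{w} K} (f : X ⟶ Y) :
    Epi f ↔ ∀ a, Function.Surjective (f.app a).hom.hom := by
  rw [NatTrans.epi_iff_epi_app]
  exact forall_congr' fun a => FGModuleCat.epi_iff_surjective _

theorem FGModuleCat.hom_ext_apply {A B : FGModuleCat.{w} K} {f g : A ⟶ B}
    (h : ∀ x, f.hom.hom x = g.hom.hom x) : f = g :=
  FGModuleCat.hom_ext (LinearMap.ext h)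

theorem shortExact_of_app {S : ShortComplex (C ⥤ FGModuleCat.{w} K)}
    (hf : ∀ a, Function.Injective (S.f.app a).hom.hom)
    (hg : ∀ a, Function.Surjective (S.g.app a).hom.hom)
    (hex : ∀ a y, (S.g.app a).hom.hom y = 0 → ∃ x, (S.f.app a).hom.hom x = y) :
    S.ShortExact := by
  have hmono := (mono_iff_injective_app S.f).2 hf
  have hepi := (epi_iff_surjective_app S.g).2 hg
  refine ⟨S.exact_of_f_is_kernel (Limits.KernelFork.IsLimit.ofι' _ _ fun {A} k hk => ?_)⟩
  have hk' : ∀ a (x : A.obj a), (k.app a).hom.hom x ∈ LinearMap.range (S.f.app a).hom.hom := by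
    intro a x
    refine hex a _ ?_
    change ((k ≫ S.g).app a).hom.hom x = 0
    rw [hk]
    rfl
  -- The kernel lift is built objectwise; its naturality can be tested after the injective maps
  -- `S.f.app`.
  let r : ∀ a, A.obj a →ₗ[K] S.X₁.obj a := fun a =>
    (LinearEquiv.ofInjective _ (hf a)).symm.toLinearMap ∘ₗ (k.app a).hom.hom.codRestrict _ (hk' a)
  have hr : ∀ a x, (S.f.app a).hom.hom (r a x) = (k.app a).hom.hom x := fun a x =>
    congrArg Subtype.val ((LinearEquiv.ofInjective _ (hf a)).apply_symm_apply
      ⟨(k.app a).hom.hom x, hk' a x⟩)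
  refine ⟨{ app := fun a => FGModuleCat.ofHom (r a), naturality := ?_ }, ?_⟩
  · intro a b φ
    refine FGModuleCat.hom_ext_apply fun x => hf b ?_
    change (S.f.app b).hom.hom (r b ((A.map φ).hom.hom x)) =
      (S.X₁.map φ ≫ S.f.app b).hom.hom (r a x)
    rw [S.f.naturality, hr]
    change (A.map φ ≫ k.app b).hom.hom x = (S.X₂.map φ).hom.hom ((S.f.app a).hom.hom (r a x))
    rw [hr, k.naturality]
    rfl
  · ext a : 2
    exact FGModuleCat.hom_ext_apply (hr a)

/-- The coordinates of an element of a coinduced representation. -/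
def coindEval {ι : Type} [Finite ι] (σ : ι → C) (V : ι → FGModuleCat.{w} K) {a : C} (x : ι)
    (f : a ⟶ σ x) : (coind σ V).obj a →ₗ[K] V x where
  toFun φ := φ x ⟨⟨f⟩⟩
  map_add' _ _ := rfl
  map_smul' _ _ := rfl

theorem coind_ext {ι : Type} [Finite ι] {σ : ι → C} {V : ι → FGModuleCat.{w} K} {a : C}
    {φ ψ : (coind σ V).obj a} (h : ∀ x f, coindEval σ V x f φ = coindEval σ V x f ψ) : φ = ψ :=
  funext fun x => funext fun ⟨⟨f⟩⟩ => h x f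

variable [Quiver.IsThin C]

/-- Morphisms into a coinduced representation. -/
def coindHomEquiv {ι : Type} [Finite ι] (σ : ι → C) (V : ι → FGModuleCat.{w} K)
    (X : C ⥤ FGModuleCat.{w} K) : (X ⟶ coind σ V) ≃ₗ[K] ∀ x, X.obj (σ x) →ₗ[K] V x where
  toFun α x := (LinearMap.proj ⟨⟨𝟙 (σ x)⟩⟩) ∘ₗ (LinearMap.proj x) ∘ₗ (α.app (σ x)).hom.hom
  map_add' _ _ := rfl
  map_smul' _ _ := rfl
  invFun g :=
    { app := fun a => FGModuleCat.ofHom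
        (LinearMap.pi fun x => LinearMap.pi fun h => g x ∘ₗ (X.map h.down.some).hom.hom)
      naturality := by
        intro a b f
        refine FGModuleCat.hom_ext (LinearMap.ext fun y => funext fun x => funext fun h => ?_)
        change g x ((X.map h.down.some).hom.hom ((X.map f).hom.hom y)) = g x ((X.map _).hom.hom y)
        rw [← Subsingleton.elim (f ≫ h.down.some) (Nonempty.some _), X.map_comp]
        rfl }
  left_inv α := by
    ext a : 2
    refine FGModuleCat.hom_ext (LinearMap.ext fun y => funext fun x => funext fun h => ?_)
    change ((X.map h.down.some ≫ α.app (σ x)).hom.hom y) x ⟨⟨𝟙 _⟩⟩ = _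
    rw [α.naturality]
    rfl
  right_inv g := by
    refine funext fun x => LinearMap.ext fun y => ?_
    change g x ((X.map _).hom.hom y) = g x y
    rw [Subsingleton.elim (Nonempty.some _) (𝟙 (σ x)), X.map_id]
    rfl

theorem coindHomEquiv_comp {ι : Type} [Finite ι] (σ : ι → C) (V : ι → FGModuleCat.{w} K)
    {X Y : C ⥤ FGModuleCat.{w} K} (f : X ⟶ Y) (α : Y ⟶ coind σ V) (x : ι) :
    coindHomEquiv σ V X (f ≫ α) x = coindHomEquiv σ V Y α x ∘ₗ (f.app (σ x)).hom.hom := rfl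

theorem exists_coindEval_eq {ι : Type} [Finite ι] (σ : ι → C) (V : ι → FGModuleCat.{w} K) {a : C}
    (v : ∀ x, (a ⟶ σ x) → V x) : ∃ φ : (coind σ V).obj a, ∀ x f, coindEval σ V x f φ = v x f :=
  ⟨fun x h => v x h.down.some, fun x _ => congrArg (v x) (Subsingleton.elim _ _)⟩

theorem coindEval_coindHomEquiv_symm {ι : Type} [Finite ι] (σ : ι → C)
    (V : ι → FGModuleCat.{w} K) (X : C ⥤ FGModuleCat.{w} K) (g : ∀ x, X.obj (σ x) →ₗ[K] V x)
    {a : C} (y : X.obj a) (x : ι) (f : a ⟶ σ x) :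
    coindEval σ V x f ((((coindHomEquiv σ V X).symm g).app a).hom.hom y)
      = g x ((X.map f).hom.hom y) := by
  rw [Subsingleton.elim f (Nonempty.some ⟨f⟩)]
  rfl

/-- Maps into a coinduced representation are families of linear maps, and these extend from
subspaces over a field. -/
instance injective_coind {ι : Type} [Finite ι] (σ : ι → C) (V : ι → FGModuleCat.{w} K) :
    Injective (coind σ V) where
  factors {X Y} g f _ := by
    have hf := (mono_iff_injective_app f).1 inferInstance
    choose r hr using fun x => LinearMap.exists_leftInverse_of_injective (f.app (σ x)).hom.hom
      (LinearMap.ker_eq_bot.2 (hf (σ x)))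
    refine ⟨(coindHomEquiv σ V Y).symm fun x => coindHomEquiv σ V X g x ∘ₗ r x, ?_⟩
    apply (coindHomEquiv σ V X).injective
    funext x
    rw [coindHomEquiv_comp, LinearEquiv.apply_symm_apply, LinearMap.comp_assoc, hr,
      LinearMap.comp_id]

instance finite_hom_coind {ι : Type} [Finite ι] (σ : ι → C) (V : ι → FGModuleCat.{w} K)
    (X : C ⥤ FGModuleCat.{w} K) : Module.Finite K (X ⟶ coind σ V) :=
  Module.Finite.equiv (coindHomEquiv σ V X).symm

theorem finrank_hom_coind {ι : Type} [Fintype ι] (σ : ι → C) (V : ι → FGModuleCat.{w} K)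
    (X : C ⥤ FGModuleCat.{w} K) : Module.finrank K (X ⟶ coind σ V)
      = ∑ x, Module.finrank K (X.obj (σ x)) * Module.finrank K (V x) := by
  rw [(coindHomEquiv σ V X).finrank_eq, Module.finrank_pi_fintype]
  exact Finset.sum_congr rfl fun x _ => Module.finrank_linearMap K K _ _

end Coinduction

/-! ### Counting dimensions in the long exact Ext sequence. -/

section EulerForm

open Abelian

variable {K : Type w} [Field K] {C : Type u} [Category.{v} C] [Abelian C] [Linear K C]

/-- The first four terms of the long exact sequence of a short exact sequence with injective
middle term, counted. -/
theorem finrank_hom_sub_finrank_ext [HasExt.{w'} C] {S : ShortComplex C} (hS : S.ShortExact)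
    (X : C) [Injective S.X₂] [Module.Finite K (X ⟶ S.X₂)] [Module.Finite K (X ⟶ S.X₃)] :
    Module.Finite K (X ⟶ S.X₁) ∧ Module.Finite K (Ext X S.X₁ 1) ∧
      (Module.finrank K (X ⟶ S.X₁) : ℚ) - Module.finrank K (Ext X S.X₁ 1)
        = Module.finrank K (X ⟶ S.X₂) - Module.finrank K (X ⟶ S.X₃) := by
  have hmono := hS.mono_f
  let f := Linear.rightComp K X S.f
  let g := Linear.rightComp K X S.g
  let d : (X ⟶ S.X₃) →ₗ[K] Ext X S.X₁ 1 :=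
    Ext.postcompOfLinear hS.extClass K X (zero_add 1) ∘ₗ Ext.linearEquiv₀.symm.toLinearMap
  have hf : Function.Injective f := fun a b h => (cancel_mono S.f).1 h
  have hfg : LinearMap.range f = LinearMap.ker g := by
    ext a
    constructor
    · rintro ⟨b, rfl⟩
      simp [f, g]
    · intro ha
      exact ⟨hS.exact.lift a ha, hS.exact.lift_f a ha⟩
  have hgd : LinearMap.range g = LinearMap.ker d := by
    ext a
    constructor
    · rintro ⟨b, rfl⟩
      simp [g, d, Ext.linearEquiv₀, Ext.addEquiv₀, Ext.homEquiv₀, ← Ext.mk₀_comp_mk₀]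
    · intro ha
      obtain ⟨x, hx⟩ := Ext.covariant_sequence_exact₃ X hS (Ext.mk₀ a) (zero_add 1) ha
      obtain ⟨b, rfl⟩ := (Ext.mk₀_bijective X S.X₂).2 x
      rw [Ext.mk₀_comp_mk₀] at hx
      exact ⟨b, (Ext.mk₀_bijective X S.X₃).1 hx⟩
  have hd : Function.Surjective d := by
    intro a
    obtain ⟨x, hx⟩ := Ext.covariant_sequence_exact₁ X hS a (Ext.eq_zero_of_injective _) (zero_add 1)
    obtain ⟨b, rfl⟩ := (Ext.mk₀_bijective X S.X₃).2 x
    exact ⟨b, hx⟩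
  have h1 : Module.Finite K (X ⟶ S.X₁) := Module.Finite.of_injective f hf
  have h2 : Module.Finite K (Ext X S.X₁ 1) := Module.Finite.of_surjective d hd
  refine ⟨h1, h2, ?_⟩
  have e1 := LinearMap.finrank_range_add_finrank_ker g
  have e2 := LinearMap.finrank_range_add_finrank_ker d
  rw [← hfg, LinearMap.finrank_range_of_inj hf] at e1
  rw [← hgd, LinearMap.range_eq_top.2 hd, finrank_top] at e2
  rw [← e1, ← e2]
  push_cast
  ring

end EulerForm

end

noncomputable section

/-! ### Injective envelopes and the standard resolution for quiver representations. -/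

section QuiverRepresentations

namespace GraphOrientation

variable {I : Type u} {G : SimpleGraph I} {K : Type w} [Field K] {Q : GraphOrientation G}

variable (Q) in
/-- A vertex of `Q` as an object of the path category. -/
def vert (i : I) : Paths Q.Vertex := (Paths.of Q.Vertex).obj i

/-- An arrow of `Q` as a morphism of the path category. -/
def arr {i j : I} (h : Q.arrow i j) : Q.vert i ⟶ Q.vert j :=
  (Paths.of Q.Vertex).map (X := i) (Y := j) ⟨h⟩

/-- Paths from `a` are freely generated by appending arrows; `resd_surjective` uses this to solve
its equations. -/
theorem exists_path_recursion {a : Paths Q.Vertex} (M : Paths Q.Vertex → Type v) (z : M a)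
    (step : ∀ {b c : I}, Q.arrow b c → (a ⟶ Q.vert b) → M (Q.vert b) → M (Q.vert c)) :
    ∃ ψ : ∀ b, (a ⟶ b) → M b, ∀ (b c : I) (h : Q.arrow b c) (p : a ⟶ Q.vert b),
      ψ _ (p ≫ arr h) = step h p (ψ _ p) :=
  ⟨fun b p => @Quiver.Path.rec Q.Vertex _ a (fun b _ => M b) z
    (fun p (e : PLift (Q.arrow _ _)) ih => step e.down p ih) b p, fun _ _ _ _ => rfl⟩

theorem path_induction {a : Paths Q.Vertex} {P : ∀ b : Paths Q.Vertex, (a ⟶ b) → Prop}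
    (id : P a (𝟙 a)) (comp : ∀ (b c : I) (h : Q.arrow b c) (p : a ⟶ Q.vert b), P _ p →
      P _ (p ≫ arr h)) (b : Paths Q.Vertex) (p : a ⟶ b) : P b p := by
  refine Paths.induction_fixed_source (V := Q.Vertex) (P := fun {b} p => P b p) id ?_ p
  intro u v p e ih
  exact comp u v e.down p ih

theorem dimVec_simpleRep [DecidableEq I] (i : I) : dimVec (simpleRep K Q i) = simpleRoot i := by
  ext j
  change (Module.finrank K (PLift (j = i) → K) : ℚ) = _
  classical
  have : Fintype (PLift (j = i)) := Fintype.ofFinite _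
  rw [Module.finrank_pi, simpleRoot, Pi.single_apply]
  split_ifs with h
  · have : Unique (PLift (j = i)) := ⟨⟨⟨h⟩⟩, fun ⟨_⟩ => rfl⟩
    simp
  · have : IsEmpty (PLift (j = i)) := ⟨fun x => h x.down⟩
    simp

variable (K Q) in
/-- The space of a simple representation at its vertex is one-dimensional. -/
def simpleRepCoord (i : I) : (simpleRep K Q i).obj (Q.vert i) ≃ₗ[K] K :=
  haveI : Unique (PLift (i = i)) := ⟨⟨⟨rfl⟩⟩, fun ⟨_⟩ => rfl⟩
  LinearEquiv.funUnique (PLift (i = i)) K K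

theorem dimVec_le_of_mono {X Y : FDRep K Q} (f : X ⟶ Y) [Mono f] : dimVec X ≤ dimVec Y := fun _ =>
  Nat.cast_le.2 (LinearMap.finrank_le_finrank_of_injective ((mono_iff_injective_app f).1 ‹_› _))

/-- By essentiality, each envelope embeds in the other. -/
theorem IsInjectiveEnvelope.dimVec_eq {S E E' : FDRep K Q} (hE : IsInjectiveEnvelope S E)
    (hE' : IsInjectiveEnvelope S E') : dimVec E = dimVec E' := by
  have key : ∀ {E E' : FDRep K Q}, IsInjectiveEnvelope S E → IsInjectiveEnvelope S E' →
      dimVec E ≤ dimVec E' := by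
    rintro E E' ⟨_, f, hf, hess⟩ ⟨_, f', hf', _⟩
    have : Mono (Injective.factorThru f' f) :=
      hess _ _ (by rwa [Injective.comp_factorThru])
    exact dimVec_le_of_mono (Injective.factorThru f' f)
  exact le_antisymm (key hE hE') (key hE' hE)

variable (K Q) in
/-- The indecomposable injective representation attached to a vertex. -/
def injRep (i : I) : FDRep K Q :=
  coind (fun _ : Unit => Q.vert i) fun _ => FGModuleCat.of K K

/-- The coordinates of an element of an indecomposable injective representation. -/
def injEval (i : I) {b : Paths Q.Vertex} (f : b ⟶ Q.vert i) : (injRep K Q i).obj b →ₗ[K] K :=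
  coindEval (fun _ : Unit => Q.vert i) (fun _ => FGModuleCat.of K K) () f

theorem injRep_ext {i : I} {b : Paths Q.Vertex} {φ ψ : (injRep K Q i).obj b}
    (h : ∀ f, injEval i f φ = injEval i f ψ) : φ = ψ :=
  coind_ext fun _ f => h f

theorem injEval_map (i : I) {a b : Paths Q.Vertex} (p : a ⟶ b) (f : b ⟶ Q.vert i)
    (φ : (injRep K Q i).obj a) :
    injEval i f (((injRep K Q i).map p).hom.hom φ) = injEval i (p ≫ f) φ := rfl

theorem dimVec_injRep [Fintype I] [DecidableEq I] (i : I) :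
    dimVec (injRep K Q i) = Q.gammaRoot i := by
  classical
  ext j
  rw [gammaRoot_apply]
  change (Module.finrank K (Unit → PLift (Nonempty (Q.vert j ⟶ Q.vert i)) → K) : ℚ) = _
  have : Fintype (PLift (Nonempty (Q.vert j ⟶ Q.vert i))) := Fintype.ofFinite _
  rw [Module.finrank_pi_fintype, Finset.univ_unique, Finset.sum_singleton, Module.finrank_pi]
  have hiff : Nonempty (Q.vert j ⟶ Q.vert i) ↔ Relation.ReflTransGen Q.arrow j i :=
    nonempty_path_iff
  split_ifs with h
  · have : Unique (PLift (Nonempty (Q.vert j ⟶ Q.vert i))) := ⟨⟨⟨hiff.2 h⟩⟩, fun ⟨_⟩ => rfl⟩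
    simp
  · have : IsEmpty (PLift (Nonempty (Q.vert j ⟶ Q.vert i))) := ⟨fun x => h (hiff.1 x.down)⟩
    simp

section Resolution

variable {n : ℕ} (e : Fin n ≃ I) (Y : FDRep K Q)

/-- The index set of the arrows of `Q`, for a numbering `e` of the vertices. -/
abbrev ArrowIdx (Q : GraphOrientation G) (e : Fin n ≃ I) : Type :=
  { p : Fin n × Fin n // Q.arrow (e p.1) (e p.2) }

/-- The middle term of the standard injective resolution. -/
def resInj₀ : FDRep K Q :=
  coind (fun x : Fin n => Q.vert (e x)) fun x => Y.obj (Q.vert (e x))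

/-- The last term of the standard injective resolution. -/
def resInj₁ : FDRep K Q :=
  coind (fun p : ArrowIdx Q e => Q.vert (e p.1.1)) fun p => Y.obj (Q.vert (e p.1.2))

/-- The coordinates in the middle term of the standard injective resolution. -/
def eval₀ {a : Paths Q.Vertex} (x : Fin n) (f : a ⟶ Q.vert (e x)) :
    (resInj₀ e Y).obj a →ₗ[K] Y.obj (Q.vert (e x)) :=
  coindEval (fun x : Fin n => Q.vert (e x)) (fun x => Y.obj (Q.vert (e x))) x f

/-- The coordinates in the last term of the standard injective resolution. -/
def eval₁ {a : Paths Q.Vertex} (p : ArrowIdx Q e) (f : a ⟶ Q.vert (e p.1.1)) :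
    (resInj₁ e Y).obj a →ₗ[K] Y.obj (Q.vert (e p.1.2)) :=
  coindEval (fun p : ArrowIdx Q e => Q.vert (e p.1.1)) (fun p => Y.obj (Q.vert (e p.1.2))) p f

variable {e Y}

theorem resInj₀_ext {a : Paths Q.Vertex} {φ ψ : (resInj₀ e Y).obj a}
    (h : ∀ x f, eval₀ e Y x f φ = eval₀ e Y x f ψ) : φ = ψ :=
  coind_ext h

theorem resInj₁_ext {a : Paths Q.Vertex} {φ ψ : (resInj₁ e Y).obj a}
    (h : ∀ p f, eval₁ e Y p f φ = eval₁ e Y p f ψ) : φ = ψ :=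
  coind_ext h

theorem eval₀_map {a b : Paths Q.Vertex} (q : a ⟶ b) (x : Fin n) (f : b ⟶ Q.vert (e x))
    (φ : (resInj₀ e Y).obj a) :
    eval₀ e Y x f (((resInj₀ e Y).map q).hom.hom φ) = eval₀ e Y x (q ≫ f) φ := rfl

end Resolution

variable [Quiver.IsThin (Paths Q.Vertex)]

instance injective_injRep (i : I) : Injective (injRep K Q i) := injective_coind _ _

variable (K Q) in
/-- The embedding of a simple representation in the corresponding injective representation. -/
def simpleRepToInjRep (i : I) : simpleRep K Q i ⟶ injRep K Q i :=
  (coindHomEquiv (fun _ : Unit => Q.vert i) (fun _ => FGModuleCat.of K K) (simpleRep K Q i)).symm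
    fun _ => simpleRepCoord K Q i

theorem injEval_simpleRepToInjRep (i : I) (y : (simpleRep K Q i).obj (Q.vert i))
    (f : Q.vert i ⟶ Q.vert i) :
    injEval i f (((simpleRepToInjRep K Q i).app (Q.vert i)).hom.hom y)
      = simpleRepCoord K Q i y := by
  rw [Subsingleton.elim f (𝟙 _)]
  refine (coindEval_coindHomEquiv_symm _ _ _ _ _ _ _).trans ?_
  rw [CategoryTheory.Functor.map_id]
  rfl

/-- For essentiality: if `y` has a nonzero coordinate along a path `p` to `i`, then `p` carries `y`
to a nonzero element of the image of `S_i`, which `g` does not kill. -/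
theorem isInjectiveEnvelope_injRep (i : I) :
    IsInjectiveEnvelope (simpleRep K Q i) (injRep K Q i) := by
  refine ⟨inferInstance, simpleRepToInjRep K Q i, ?_, fun Z g hg => ?_⟩
  · rw [mono_iff_injective_app]
    intro b y y' h
    by_cases hb : Q.vert i = b
    · subst hb
      apply (simpleRepCoord K Q i).injective
      rw [← injEval_simpleRepToInjRep i y (𝟙 _), h, injEval_simpleRepToInjRep]
    · exact funext fun x => absurd x.down.symm hb
  · rw [mono_iff_injective_app] at hg ⊢
    intro b
    refine (injective_iff_map_eq_zero _).2 fun y hy => injRep_ext fun p => ?_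
    obtain ⟨c, hc'⟩ := (simpleRepCoord K Q i).surjective (injEval i p y)
    have hc : ((simpleRepToInjRep K Q i).app (Q.vert i)).hom.hom c
        = ((injRep K Q i).map p).hom.hom y := by
      refine injRep_ext fun f => ?_
      rw [injEval_simpleRepToInjRep, hc', injEval_map, Subsingleton.elim (p ≫ f) p]
    have h0 : ((simpleRepToInjRep K Q i ≫ g).app (Q.vert i)).hom.hom c = 0 := by
      change (g.app (Q.vert i)).hom.hom (((simpleRepToInjRep K Q i).app (Q.vert i)).hom.hom c) = 0
      rw [hc]
      change ((injRep K Q i).map p ≫ g.app (Q.vert i)).hom.hom y = 0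
      rw [g.naturality]
      change (Z.map p).hom.hom ((g.app b).hom.hom y) = 0
      rw [hy, map_zero]
    rw [← hc', (injective_iff_map_eq_zero _).1 (hg (Q.vert i)) c h0, map_zero, map_zero]

section Resolution

variable {n : ℕ} (e : Fin n ≃ I) (Y : FDRep K Q)

/-- The embedding of a representation in the standard injective representation. -/
def resι : Y ⟶ resInj₀ e Y :=
  (coindHomEquiv (fun x : Fin n => Q.vert (e x)) (fun x => Y.obj (Q.vert (e x))) Y).symm
    fun _ => LinearMap.id

/-- The differential of the standard injective resolution. -/
def resd : resInj₀ e Y ⟶ resInj₁ e Y :=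
  (coindHomEquiv (fun p : ArrowIdx Q e => Q.vert (e p.1.1)) (fun p => Y.obj (Q.vert (e p.1.2)))
    (resInj₀ e Y)).symm fun p =>
      (Y.map (arr p.2)).hom.hom ∘ₗ eval₀ e Y p.1.1 (𝟙 _) - eval₀ e Y p.1.2 (arr p.2)

variable {e Y}

theorem eval₀_resι (a : Paths Q.Vertex) (y : Y.obj a) (x : Fin n) (f : a ⟶ Q.vert (e x)) :
    eval₀ e Y x f (((resι e Y).app a).hom.hom y) = (Y.map f).hom.hom y :=
  coindEval_coindHomEquiv_symm _ _ _ _ _ _ _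

theorem eval₁_resd (a : Paths Q.Vertex) (φ : (resInj₀ e Y).obj a) (p : ArrowIdx Q e)
    (f : a ⟶ Q.vert (e p.1.1)) :
    eval₁ e Y p f (((resd e Y).app a).hom.hom φ)
      = (Y.map (arr p.2)).hom.hom (eval₀ e Y p.1.1 f φ) - eval₀ e Y p.1.2 (f ≫ arr p.2) φ := by
  refine (coindEval_coindHomEquiv_symm _ _ _ _ _ _ _).trans ?_
  rw [LinearMap.sub_apply, eval₀_map, LinearMap.comp_apply, eval₀_map, Category.comp_id]

theorem resι_comp_resd : resι e Y ≫ resd e Y = 0 := by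
  ext a : 2
  refine FGModuleCat.hom_ext_apply fun y => resInj₁_ext fun p f => ?_
  change eval₁ e Y p f (((resd e Y).app a).hom.hom (((resι e Y).app a).hom.hom y)) = 0
  rw [eval₁_resd, eval₀_resι, eval₀_resι, Y.map_comp, sub_eq_zero]
  rfl

theorem resι_injective (a : Paths Q.Vertex) :
    Function.Injective ((resι e Y).app a).hom.hom := by
  obtain ⟨x, rfl⟩ : ∃ x, Q.vert (e x) = a := e.surjective a
  refine (injective_iff_map_eq_zero _).2 fun y hy => ?_
  have := eval₀_resι _ y x (𝟙 _)
  rw [Y.map_id, hy, map_zero] at this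
  exact this.symm

theorem resd_surjective (a : Paths Q.Vertex) :
    Function.Surjective ((resd e Y).app a).hom.hom := by
  intro g
  -- The coordinates of `g` are indexed by numbered arrows, the path recursion by arrows between
  -- vertices; `HEq` bridges the two indexings.
  have hg : ∀ (b c : I) (_ : Q.arrow b c) (f : a ⟶ Q.vert b), ∃ y : Y.obj (Q.vert c),
      ∀ (p : ArrowIdx Q e) (_ : b = e p.1.1) (_ : c = e p.1.2) (f' : a ⟶ Q.vert (e p.1.1)),
        HEq y (eval₁ e Y p f' g) := by
    intro b c h f
    obtain ⟨x, rfl⟩ := e.surjective b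
    obtain ⟨z, rfl⟩ := e.surjective c
    refine ⟨eval₁ e Y ⟨(x, z), h⟩ f g, ?_⟩
    rintro ⟨⟨x', z'⟩, h'⟩ hx hz f'
    obtain rfl := e.injective hx
    obtain rfl := e.injective hz
    rw [Subsingleton.elim f f']
  choose g' hg' using hg
  -- Solve `ψ(f h) = Y(h) ψ(f) - g(h, f)` along paths, starting from `0` at the trivial path.
  obtain ⟨ψ, hψ⟩ := exists_path_recursion (a := a) (fun b => Y.obj b) (0 : Y.obj a)
    fun h f y => (Y.map (arr h)).hom.hom y - g' _ _ h f
  obtain ⟨φ, hφ⟩ : ∃ φ : (resInj₀ e Y).obj a, ∀ x f, eval₀ e Y x f φ = ψ _ f :=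
    exists_coindEval_eq (fun x : Fin n => Q.vert (e x))
      (fun x => Y.obj (Q.vert (e x))) fun x f => ψ _ f
  refine ⟨φ, resInj₁_ext fun p f => ?_⟩
  rw [eval₁_resd, hφ, hφ]
  refine (congrArg (_ - ·) (hψ _ _ p.2 f)).trans ?_
  refine (sub_sub_cancel _ _).trans ?_
  exact eq_of_heq (hg' _ _ _ _ p rfl rfl f)

/-- A kernel element satisfies `φ(f h) = Y(h) φ(f)`, so it is determined by its coordinate at the
trivial path. -/
theorem exists_resι_eq (a : Paths Q.Vertex) (φ : (resInj₀ e Y).obj a)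
    (hφ : ((resd e Y).app a).hom.hom φ = 0) : ∃ y, ((resι e Y).app a).hom.hom y = φ := by
  obtain ⟨x, rfl⟩ : ∃ x, Q.vert (e x) = a := e.surjective a
  refine ⟨eval₀ e Y x (𝟙 _) φ, ?_⟩
  have key : ∀ (b : Paths Q.Vertex) (f : Q.vert (e x) ⟶ b) (z : Fin n) (hz : b = Q.vert (e z)),
      (Y.map (f ≫ eqToHom hz)).hom.hom (eval₀ e Y x (𝟙 _) φ)
        = eval₀ e Y z (f ≫ eqToHom hz) φ := by
    refine path_induction (fun z hz => ?_) fun b c h p ih z hz => ?_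
    · obtain rfl : x = z := e.injective hz
      simp
    · have hc : c = e z := hz
      subst hc
      obtain ⟨t, rfl⟩ := e.surjective b
      have h1 := ih t rfl
      have h2 := eval₁_resd _ φ ⟨(t, z), h⟩ p
      rw [hφ, map_zero, eq_comm, sub_eq_zero] at h2
      simp only [eqToHom_refl, Category.comp_id] at h1 ⊢
      rw [← h2, ← h1, Y.map_comp]
      rfl
  refine resInj₀_ext fun z f => (eval₀_resι _ _ z f).trans ?_
  simpa using key _ f z rfl

variable (e Y)

/-- The standard injective resolution of a representation. -/
theorem shortExact_res : (ShortComplex.mk (resι e Y) (resd e Y) resι_comp_resd).ShortExact :=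
  shortExact_of_app resι_injective resd_surjective exists_resι_eq

end Resolution

end GraphOrientation

end QuiverRepresentations

end

noncomputable section

/-! ### The Ringel form and its values on the roots `γ_j`. -/

section RingelForm

namespace GraphOrientation

variable {I : Type u} [Fintype I] [DecidableEq I] {G : SimpleGraph I} {K : Type w} [Field K]
  {Q : GraphOrientation G}

open Classical in
/-- The Ringel form of a quiver, `⟨α_i, α_j⟩ = δ_ij - #{arrows i → j}`. -/
def ringelForm (Q : GraphOrientation G) : WeightSpace I →ₗ[ℚ] WeightSpace I →ₗ[ℚ] ℚ :=
  Matrix.toBilin' (1 - Matrix.of fun i j => if Q.arrow i j then 1 else 0)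

open Classical in
theorem ringelForm_apply (x y : WeightSpace I) :
    Q.ringelForm x y = ∑ i, x i * y i - ∑ i, ∑ j, if Q.arrow i j then x i * y j else 0 := by
  rw [ringelForm, Matrix.toBilin'_apply', Matrix.sub_mulVec, dotProduct_sub, Matrix.one_mulVec]
  simp only [dotProduct, Matrix.mulVec, Finset.mul_sum, Matrix.of_apply, ite_mul, one_mul, zero_mul,
    mul_ite, mul_zero]

theorem weightSpace_bilin_ext {B B' : WeightSpace I →ₗ[ℚ] WeightSpace I →ₗ[ℚ] ℚ}
    (h : ∀ i j, B (simpleRoot i) (simpleRoot j) = B' (simpleRoot i) (simpleRoot j)) : B = B' := by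
  refine (Pi.basisFun ℚ I).ext fun i => (Pi.basisFun ℚ I).ext fun j => ?_
  rw [Pi.basisFun_apply, Pi.basisFun_apply]
  exact h i j

variable [Quiver.IsThin (Paths Q.Vertex)]

theorem isRingelForm_ringelForm : IsRingelForm K Q Q.ringelForm := by
  classical
  intro X Y
  let := HasExt.standard (FDRep K Q)
  -- `coind` takes index sets in `Type`, whereas `I` lives in `Type u`; hence the numbering.
  let e := (Fintype.equivFin I).symm
  let S := ShortComplex.mk (resι e Y) (resd e Y) resι_comp_resd
  have hS : S.ShortExact := shortExact_res e Y
  have : Injective S.X₂ := injective_coind _ _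
  have : Module.Finite K (X ⟶ S.X₂) := finite_hom_coind _ _ _
  have : Module.Finite K (X ⟶ S.X₃) := finite_hom_coind _ _ _
  obtain ⟨h1, h2, h3⟩ := finrank_hom_sub_finrank_ext (K := K) hS X
  refine ⟨h1, h2, ?_⟩
  refine Eq.trans ?_ h3.symm
  rw [ringelForm_apply]
  -- The vertex terms of the form are `dim Hom(X, resInj₀)`, the arrow terms `dim Hom(X, resInj₁)`.
  congr 1
  · refine Eq.trans ?_ (congrArg Nat.cast (finrank_hom_coind _ _ X).symm)
    rw [← e.sum_comp]
    push_cast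
    rfl
  · refine Eq.trans ?_ (congrArg Nat.cast (finrank_hom_coind _ _ X).symm)
    rw [← e.sum_comp, Finset.sum_congr rfl fun i _ => (e.sum_comp _).symm,
      ← Finset.sum_product', ← Finset.sum_filter, Finset.univ_product_univ]
    push_cast
    rw [Finset.sum_subtype (p := fun p : Fin _ × Fin _ => Q.arrow (e p.1) (e p.2))]
    · rfl
    · simp

theorem existsUnique_isRingelForm :
    ∃! B : WeightSpace I →ₗ[ℚ] WeightSpace I →ₗ[ℚ] ℚ, IsRingelForm K Q B := by
  refine ⟨Q.ringelForm, isRingelForm_ringelForm, fun B hB => weightSpace_bilin_ext fun i j => ?_⟩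
  have h := (hB (simpleRep K Q i) (simpleRep K Q j)).2.2
  have h' := (isRingelForm_ringelForm (simpleRep K Q i) (simpleRep K Q j)).2.2
  rw [← h'] at h
  simpa only [dimVec_simpleRep] using h

/-- On simple roots the form is `dim Hom(S_i, I_j) = dim (S_i)_j`, as Ext¹ into an injective
vanishes. -/
theorem IsRingelForm.apply_gammaRoot {B : WeightSpace I →ₗ[ℚ] WeightSpace I →ₗ[ℚ] ℚ}
    (hB : IsRingelForm K Q B) (x : WeightSpace I) (j : I) : B x (Q.gammaRoot j) = x j := by
  have h : B.flip (Q.gammaRoot j) = LinearMap.proj j := by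
    refine (Pi.basisFun ℚ I).ext fun i => ?_
    have h1 := (hB (simpleRep K Q i) (injRep K Q j)).2.2
    let := HasExt.standard (FDRep K Q)
    have : Subsingleton (Ext1 (simpleRep K Q i) (injRep K Q j)) :=
      Abelian.Ext.subsingleton_of_injective _ _ 0
    have h0 : Module.finrank K (Ext1 (simpleRep K Q i) (injRep K Q j)) = 0 :=
      Module.finrank_zero_of_subsingleton
    rw [h0, Nat.cast_zero, sub_zero, dimVec_simpleRep,
      dimVec_injRep] at h1
    rw [Pi.basisFun_apply]
    refine h1.trans ((congrArg Nat.cast (finrank_hom_coind _ _ _)).trans ?_)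
    rw [Finset.univ_unique, Finset.sum_singleton]
    refine (congrArg Nat.cast (congrArg _ (Module.finrank_self K))).trans ?_
    rw [mul_one]
    exact congrFun (dimVec_simpleRep i) j
  exact LinearMap.congr_fun h x

end GraphOrientation

end RingelForm

end

theorem mainTheorem8 {I : Type u} [Fintype I] [DecidableEq I] (G : SimpleGraph I)
    (hG : IsDynkinADE G) (Q : GraphOrientation G) (ξ : I → ℤ) (hξ : Q.IsHeightFunction ξ)
    (τ : WeightSpace I ≃ₗ[ℚ] WeightSpace I) (hτ : Q.IsAdaptedCoxeter τ)
    (K : Type w) [Field K] (i j : I) (m : ℤ) (hm : 1 ≤ m) :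
    (Odd (m + ξ i - ξ j - 1) → invQuantumCartanCoeff G i j m = 0) ∧
    (∀ k : ℤ, m + ξ i - ξ j - 1 = 2 * k →
      invQuantumCartanCoeff G i j m
        = scalarProd G ((τ ^ k) (Q.gammaRoot i)) (fundWeight G j)) ∧
    (∃! B : WeightSpace I →ₗ[ℚ] WeightSpace I →ₗ[ℚ] ℚ, GraphOrientation.IsRingelForm K Q B) ∧
    (∀ a : I, ∃ E : GraphOrientation.FDRep K Q,
      GraphOrientation.IsInjectiveEnvelope (GraphOrientation.simpleRep K Q a) E) ∧
    (∀ B : WeightSpace I →ₗ[ℚ] WeightSpace I →ₗ[ℚ] ℚ, GraphOrientation.IsRingelForm K Q B →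
      ∀ E : I → GraphOrientation.FDRep K Q,
      (∀ a : I, GraphOrientation.IsInjectiveEnvelope (GraphOrientation.simpleRep K Q a) (E a)) →
      (∀ a : I, GraphOrientation.dimVec (E a) = Q.gammaRoot a) ∧
      (∀ k : ℤ, m + ξ i - ξ j - 1 = 2 * k →
        invQuantumCartanCoeff G i j m
          = B ((τ ^ k) (GraphOrientation.dimVec (E i))) (GraphOrientation.dimVec (E j)))) := by
  have hA := hG.isAcyclic
  have hdet := hG.det_cartanMat_ne_zero
  have hthin : Quiver.IsThin (Paths Q.Vertex) := fun _ _ =>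
    ⟨fun p q => hξ.subsingleton_path hA p q⟩
  have hcoeff : ∀ k : ℤ, m + ξ i - ξ j - 1 = 2 * k →
      invQuantumCartanCoeff G i j m = (τ ^ k) (Q.gammaRoot i) j := by
    intro k hk
    rw [invQuantumCartanCoeff_eq G i j m hm, hτ.zpow_gammaRoot_apply hdet hA hξ]
    -- The parity equation says `m - 1 = 2k + ξ_j - ξ_i`.
    exact congrArg (chebyshevAdj G · i j) (by omega)
  refine ⟨fun hodd => ?_, fun k hk => ?_, GraphOrientation.existsUnique_isRingelForm,
    fun a => ⟨_, GraphOrientation.isInjectiveEnvelope_injRep a⟩, fun B hB E hE => ?_⟩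
  · obtain ⟨n, hn⟩ := Int.eq_ofNat_of_zero_le (show 0 ≤ m - 1 by omega)
    rw [invQuantumCartanCoeff_eq G i j m hm, hn]
    refine (hξ.chebyshevAdj_of_odd n).1 i j ?_
    convert hodd using 1
    change m - 1 = (n : ℤ) at hn
    omega
  · rw [hcoeff k hk, scalarProd_fundWeight hdet]
  · have hdim : ∀ a, GraphOrientation.dimVec (E a) = Q.gammaRoot a := fun a =>
      ((hE a).dimVec_eq (GraphOrientation.isInjectiveEnvelope_injRep a)).trans
        (GraphOrientation.dimVec_injRep a)
    refine ⟨hdim, fun k hk => ?_⟩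
    rw [hdim, hdim, hB.apply_gammaRoot, hcoeff k hk]
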